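/- Let $d\ge 0$ be an integer, $M>0$, $\Gamma\ge 0$, $\nu\ge 0$ with $\Gamma+\nu>0$, and let $\beta:[0,\infty)\to[0,\infty)$ be continuous with $\mathcal B(t):=\int_0^t\beta_s\,ds\to\infty$ as $t\to\infty$ (for example, a positive constant). Consider the phase space Langevin diffusion (PSLD) forward SDE for $z_t=(x_t,m_t)\in\mathbb R^{d}\times\mathbb R^d$, $$dz_t=\Big(\tfrac{\beta_t}{2}\begin{pmatrix}-\Gamma & M^{-1}\\ -1&-\nu\end{pmatrix}\otimes I_d\Big)z_t\,dt+\Big(\begin{pmatrix}\sqrt{\Gamma\beta_t}&0\\0&\sqrt{M\nu\beta_t}\end{pmatrix}\otimes I_d\Big)dw_t ,$$ where $w$ is a standard $2d$-dimensional Wiener process and $z_0$ is independent of $w$. Then there are vectors $\mu_t(\zeta)\in\mathbb R^{2d}$ ($\zeta\in\mathbb R^{2d}$, $t\ge0$) and positive semidefinite matrices $\Sigma_t^{(a,b)}\in\mathbb R^{2d\times 2d}$ ($a,b\ge 0$, $t\ge 0$), depending only on $d,\Gamma,M,\nu,\beta$ and the displayed arguments, such that the following hold. 1. For every solution and every $t\ge0$,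 the perturbation kernel is Gaussian: $p(z_t\mid z_0)=\mathcal N\big(\mu_t(z_0),\Sigma^{(0,0)}_t\big)$ for almost every $z_0$ with respect to the law of the initial value. More generally, if $z_0\sim\mathcal N(\zeta,\operatorname{diag}(a,b)\otimes I_d)$, then $z_t\sim\mathcal N\big(\mu_t(\zeta),\Sigma_t^{(a,b)}\big)$ for every $t\ge 0$. 2. As $t\to\infty$, $\mu_t(\zeta)\to 0$ for every $\zeta$, and $\Sigma^{(a,b)}_t\to\operatorname{diag}(1,M)\otimes I_d$ for all $a,b\ge0$. 3. Consequently $\mathcal N\big(\mu_t(\zeta),\Sigma_t^{(a,b)}\big)$ converges weakly to the prior $\mathcal N(0,I_d)\otimes\mathcal N(0,M I_d)$ as $t\to\infty$, for all $\zeta$ and all $a,b\ge 0$; and for every solution, whatever the law of $z_0$, the law of $z_t$ converges weakly to this prior. 4. Suppose in addition that the damping is critical, $(\Gamma-\nu)^2=4M^{-1}$. Write $\mathcal B=\mathcal B(t)$ and $\zeta=(x_0,m_0)$. Then for all $t\ge 0$ and $a,b\ge 0$, $$\mu_t(\zeta)=e^{-\frac{\nu+\Gamma}{4}\mathcal B}\begin{pmatrix}\frac{\nu-\Gamma}{4}\mathcal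 B x_0+\frac{(\Gamma-\nu)^2}{8}\mathcal B m_0+x_0\\[2pt] -\frac12\mathcal B x_0+\frac{\Gamma-\nu}{4}\mathcal B m_0+m_0\end{pmatrix},\qquad \Sigma_t^{(a,b)}=e^{-\frac{\Gamma+\nu}{2}\mathcal B}\begin{pmatrix}s^{xx}&s^{xm}\\ s^{xm}&s^{mm}\end{pmatrix}\otimes I_d,$$ where $$s^{xx}=\tfrac{M^{-1}}4\mathcal B^2a+\tfrac{M^{-2}}4\mathcal B^2b+\tfrac{\nu-\Gamma}2\mathcal Ba-\tfrac{M^{-1}}2\mathcal B^2+\tfrac{\Gamma-\nu}2\mathcal B+\big(e^{\frac{\Gamma+\nu}{2}\mathcal B}-1\big)+a,$$ $$s^{xm}=\tfrac{\Gamma-\nu}8\mathcal B^2a+\tfrac{(\Gamma-\nu)^3}{32}\mathcal B^2b-\tfrac12\mathcal Ba+\tfrac{M^{-1}}2\mathcal Bb+\tfrac{\nu-\Gamma}4\mathcal B^2,$$ $$s^{mm}=\tfrac14\mathcal B^2a+\tfrac{M^{-1}}4\mathcal B^2b+\tfrac{\Gamma-\nu}2\mathcal Bb-\tfrac12\mathcal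 B^2+\tfrac{M(\nu-\Gamma)}2\mathcal B+M\big(e^{\frac{\Gamma+\nu}{2}\mathcal B}-1\big)+b.$$ -/

import Mathlib

open MeasureTheory ProbabilityTheory Filter Topology
open scoped NNReal Matrix Kronecker BoundedContinuousFunction

universe u

/-- The phase space `ℝ^{2d}`. The coordinate `(0, k)` of a point is the `k`-th coordinate of its
position `x`, the coordinate `(1, k)` is the `k`-th coordinate of its momentum `m`. -/
abbrev PhaseSpace (d : ℕ) : Type := EuclideanSpace ℝ (Fin 2 × Fin d)

/-- The point `z = (x, m)` of phase space with position `x` and momentum `m`. -/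
noncomputable def phasePoint {d : ℕ} (x m : EuclideanSpace ℝ (Fin d)) : PhaseSpace d :=
  WithLp.toLp 2 (fun p : Fin 2 × Fin d => ![x p.2, m p.2] p.1)

/-- The Kronecker product `A ⊗ I_d`, for a `2 × 2` matrix `A`. -/
noncomputable def blockMatrix (d : ℕ) (A : Matrix (Fin 2) (Fin 2) ℝ) :
    Matrix (Fin 2 × Fin d) (Fin 2 × Fin d) ℝ :=
  A ⊗ₖ (1 : Matrix (Fin d) (Fin d) ℝ)

/-- The drift matrix `F(t) = (β_t / 2) [[-Γ, M⁻¹], [-1, -ν]] ⊗ I_d`. -/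
noncomputable def psldDrift (d : ℕ) (Γ M ν : ℝ) (β : ℝ → ℝ) (t : ℝ) :
    Matrix (Fin 2 × Fin d) (Fin 2 × Fin d) ℝ :=
  blockMatrix d ((β t / 2) • !![-Γ, M⁻¹; -1, -ν])

/-- The diffusion matrix `G(t) = diag(√(Γ β_t), √(M ν β_t)) ⊗ I_d`. -/
noncomputable def psldDiffusion (d : ℕ) (Γ M ν : ℝ) (β : ℝ → ℝ) (t : ℝ) :
    Matrix (Fin 2 × Fin d) (Fin 2 × Fin d) ℝ :=
  blockMatrix d !![√(Γ * β t), 0; 0, √(M * ν * β t)]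

section Stochastic

variable {Ω : Type*} [MeasurableSpace Ω] {ι : Type*} [Fintype ι]

/-- `W` is a standard Wiener process with coordinates indexed by `ι`: its coordinates are
independent standard real Brownian motions. -/
structure IsStandardWiener (W : ι → ℝ≥0 → Ω → ℝ) (P : Measure Ω) : Prop where
  brownian : ∀ i, IsBrownianReal (W i) P
  indep : iIndepFun (fun i ω t => W i t ω) P

/-- The `n`-th left-endpoint Riemann sum, over the partition of `[0, t]` into `n` equal parts,
of the stochastic integral `∫₀ᵗ G(s) dW_s`. -/
noncomputable def wienerSum (G : ℝ → Matrix ι ι ℝ) (W : ι → ℝ≥0 → Ω → ℝ) (t : ℝ≥0) (n : ℕ)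
    (ω : Ω) : EuclideanSpace ℝ ι :=
  ∑ k ∈ Finset.range n, WithLp.toLp 2
    (G ((k : ℝ) * t / n) *ᵥ fun j => W j ((k + 1) * t / n) ω - W j (k * t / n) ω)

/-- `Y = ∫₀ᵗ G(s) dW_s` almost surely, for a continuous deterministic integrand `G`: the
stochastic integral is the limit in probability of its left-endpoint Riemann sums. -/
def IsWienerIntegral (G : ℝ → Matrix ι ι ℝ) (W : ι → ℝ≥0 → Ω → ℝ) (t : ℝ≥0)
    (Y : Ω → EuclideanSpace ℝ ι) (P : Measure Ω) : Prop :=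
  TendstoInMeasure P (wienerSum G W t) atTop Y

/-- `Z` is a solution, driven by the standard Wiener process `W`, of the linear stochastic
differential equation `dZ_t = F(t) Z_t dt + G(t) dW_t`, with an arbitrary random initial value
`Z 0` that is independent of `W`.
As the noise is additive, `Z` is a functional of `Z 0` and `W`; no filtration is needed. -/
structure IsLinearSDESolution (F G : ℝ → Matrix ι ι ℝ) (W : ι → ℝ≥0 → Ω → ℝ)
    (Z : ℝ≥0 → Ω → EuclideanSpace ℝ ι) (P : Measure Ω) : Prop where
  wiener : IsStandardWiener W P
  aemeasurable : ∀ t, AEMeasurable (Z t) P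
  continuous : ∀ᵐ ω ∂P, Continuous (fun t => Z t ω)
  indep : IndepFun (Z 0) (fun ω i t => W i t ω) P
  equation : ∀ t : ℝ≥0, IsWienerIntegral G W t
    (fun ω => Z t ω - Z 0 ω -
      ∫ s in (0 : ℝ)..t, WithLp.toLp 2 (F s *ᵥ (Z s.toNNReal ω).ofLp)) P

end Stochastic

/-- `Z` is a solution of the forward SDE of phase space Langevin diffusion. -/
def IsPSLD {Ω : Type*} [MeasurableSpace Ω] (d : ℕ) (Γ M ν : ℝ) (β : ℝ → ℝ)
    (W : Fin 2 × Fin d → ℝ≥0 → Ω → ℝ) (Z : ℝ≥0 → Ω → PhaseSpace d) (P : Measure Ω) : Prop :=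
  IsLinearSDESolution (psldDrift d Γ M ν β) (psldDiffusion d Γ M ν β) W Z P

/-- The prior: the law of `z = (x, m)` under `N(x; 0, I_d) ⊗ N(m; 0, M I_d)`. -/
noncomputable def psldPrior (d : ℕ) (M : ℝ) : Measure (PhaseSpace d) :=
  ((multivariateGaussian (0 : EuclideanSpace ℝ (Fin d)) (1 : Matrix (Fin d) (Fin d) ℝ)).prod
    (multivariateGaussian (0 : EuclideanSpace ℝ (Fin d)) (M • (1 : Matrix (Fin d) (Fin d) ℝ)))).map
    (fun p => phasePoint p.1 p.2)

/-- Weak convergence of the measures `ρ t` to `π` as `t → ∞`. -/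
def ConvergesWeakly {d : ℕ} (ρ : ℝ≥0 → Measure (PhaseSpace d)) (π : Measure (PhaseSpace d)) :
    Prop :=
  ∀ f : PhaseSpace d →ᵇ ℝ, Tendsto (fun t => ∫ z, f z ∂(ρ t)) atTop (𝓝 (∫ z, f z ∂π))

/-- The explicit mean for critical damping, as a function of `B = ∫₀ᵗ β_s ds` and of the mean
`(x₀, m₀)` of the initial value. -/
noncomputable def criticalMean {d : ℕ} (Γ ν B : ℝ) (x₀ m₀ : EuclideanSpace ℝ (Fin d)) :
    PhaseSpace d :=
  Real.exp (-((ν + Γ) / 4) * B) • phasePoint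
    (((ν - Γ) / 4 * B) • x₀ + ((Γ - ν) ^ 2 / 8 * B) • m₀ + x₀)
    ((-1 / 2 * B) • x₀ + ((Γ - ν) / 4 * B) • m₀ + m₀)

/-- The explicit `2 × 2` covariance factor for critical damping, as a function of
`B = ∫₀ᵗ β_s ds` and of the covariance `diag(a, b) ⊗ I_d` of the initial value. -/
noncomputable def criticalCov (Γ M ν B a b : ℝ) : Matrix (Fin 2) (Fin 2) ℝ :=
  let xx := M⁻¹ / 4 * B ^ 2 * a + M⁻¹ ^ 2 / 4 * B ^ 2 * b + (ν - Γ) / 2 * B * a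
    - M⁻¹ / 2 * B ^ 2 + (Γ - ν) / 2 * B + (Real.exp ((Γ + ν) / 2 * B) - 1) + a
  let xm := (Γ - ν) / 8 * B ^ 2 * a + (Γ - ν) ^ 3 / 32 * B ^ 2 * b - 1 / 2 * B * a
    + M⁻¹ / 2 * B * b + (ν - Γ) / 4 * B ^ 2
  let mm := 1 / 4 * B ^ 2 * a + M⁻¹ / 4 * B ^ 2 * b + (Γ - ν) / 2 * B * b
    - 1 / 2 * B ^ 2 + M * (ν - Γ) / 2 * B + M * (Real.exp ((Γ + ν) / 2 * B) - 1) + b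
  Real.exp (-((Γ + ν) / 2) * B) • !![xx, xm; xm, mm]

/-!
The phase space Langevin equation is linear with additive noise, so everything can be read off from
the adjoint equation `v' = -Fᵀ v`. If `v` solves it, then `v(t) · Z_t - v(0) · Z_0` is the Wiener
integral `∫₀ᵗ (Gᵀ v) · dW`: a centred Gaussian variable with variance `∫₀ᵗ |Gᵀ v|²`, independent of
`Z_0`. With `v(t) = u` prescribed this gives the joint characteristic function of `(Z_0, Z_t)`
(`IsLinearSDESolution.integral_exp_mul_exp_adjoint`), and hence the conditional law of `Z_t` given
`Z_0` and the law of `Z_t` for a Gaussian initial value.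

No Itô calculus is needed for this. For a continuous path, the Riemann–Stieltjes sums of `v` against
the noise part `Y_s = Z_s - Z_0 - ∫₀ˢ F Z` converge to `v(t) · Z_t - v(0) · Z_0` by discrete
integration by parts (`tendsto_adjoint_stieltjesSum`). Each such sum involves `Y` at the points
`k t / N` only, and there `Y` is the limit in probability of sums of increments of `W` on the common
grid of mesh `t / (N n)`, for which the characteristic function is explicit
(`integral_exp_mul_exp_stieltjesSum`). One lets `n → ∞` and then `N → ∞`.

The drift is `β_s (c + N) ⊗ I_d` with `c = -(Γ + ν) / 4` and `N` a trace-free `2 × 2` matrix, so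
that `N² = δ` is scalar. In the time scale `B(t) = ∫₀ᵗ β` the propagator is therefore `E = p(B) + q(B) N`
with scalar functions `p`, `q` that are hyperbolic, affine or trigonometric times `exp (c B)`
(`exists_isPropagatorPair`). As `c < 0` and `δ < c²`, both tend to zero. The matrix `D = diag(1, M)`
satisfies `F D + D Fᵀ + G Gᵀ = 0`, so `v · D v` has derivative `|Gᵀ v|²` along the adjoint equation.
This evaluates the variance and yields the covariance `D + E (diag(a, b) - D) Eᵀ`, which tends to
`D`. For critical damping `δ = 0`, `p(B) = exp (c B)` and `q(B) = B exp (c B)`, which gives the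
explicit formulas. Weak convergence follows from the convergence of characteristic functions by
Lévy's continuity theorem; in the limit the initial value contributes its characteristic function at
zero, whatever its law.
-/

/-! ### Riemann sums over equal partitions -/

/-- Over equal partitions, sums of integrals of `h` whose last two arguments are frozen at the
endpoints of the cells converge to the integral of `h` along the diagonal. Taking `h` independent
of its first argument gives the convergence of Riemann sums. -/
theorem tendsto_sum_integral_equal_partition {h : ℝ × ℝ × ℝ → ℝ} (hh : Continuous h) {a b : ℝ}
    (hab : a ≤ b) :
    Tendsto (fun n : ℕ => ∑ k ∈ Finset.range n,
      ∫ s in (a + k * ((b - a) / n))..(a + (k + 1 : ℕ) * ((b - a) / n)),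
        h (s, a + k * ((b - a) / n), a + (k + 1 : ℕ) * ((b - a) / n)))
      atTop (𝓝 (∫ s in a..b, h (s, s, s))) := by
  have huc := (isCompact_Icc (a := a) (b := b)).prod
    ((isCompact_Icc (a := a) (b := b)).prod (isCompact_Icc (a := a) (b := b)))
    |>.uniformContinuousOn_of_continuous hh.continuousOn
  rw [Metric.uniformContinuousOn_iff] at huc
  rw [Metric.tendsto_atTop]
  intro ε hε
  obtain ⟨δ, hδ, H⟩ := huc (ε / (b - a + 1)) (by apply div_pos hε; linarith)
  obtain ⟨n₀, hn₀⟩ := exists_nat_gt ((b - a) / δ)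
  refine ⟨n₀ + 1, fun n hn => ?_⟩
  have hn1 : (n₀ : ℝ) + 1 ≤ n := by exact_mod_cast hn
  have hnpos : (0 : ℝ) < n := by
    have : (0 : ℝ) ≤ n₀ := Nat.cast_nonneg _
    linarith
  set w : ℝ := (b - a) / n with hw
  have hw0 : 0 ≤ w := div_nonneg (by linarith) hnpos.le
  have hnw : n * w = b - a := by rw [hw]; field_simp
  have hwδ : w < δ := by
    rw [hw, div_lt_iff₀ hnpos]
    rw [div_lt_iff₀ hδ] at hn₀
    nlinarith
  have hdiag : ∫ s in a..b, h (s, s, s) = ∑ k ∈ Finset.range n,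
      ∫ s in (a + k * w)..(a + (k + 1 : ℕ) * w), h (s, s, s) := by
    rw [intervalIntegral.sum_integral_adjacent_intervals (a := fun k : ℕ => a + k * w)]
    · simp [hnw]
    · intro k _
      exact (Continuous.intervalIntegrable (by fun_prop) _ _)
  have hcell : ∀ k ∈ Finset.range n,
      ‖(∫ s in (a + k * w)..(a + (k + 1 : ℕ) * w), h (s, a + k * w, a + (k + 1 : ℕ) * w)) -
        ∫ s in (a + k * w)..(a + (k + 1 : ℕ) * w), h (s, s, s)‖ ≤ ε / (b - a + 1) * w := by
    intro k hk
    have hkn : ((k + 1 : ℕ) : ℝ) ≤ n := by exact_mod_cast Finset.mem_range.mp hk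
    have hk0 : (0 : ℝ) ≤ k := Nat.cast_nonneg _
    have hkw : 0 ≤ k * w := by positivity
    have hk1 : ((k + 1 : ℕ) : ℝ) * w = k * w + w := by push_cast; ring
    have hk2 : ((k + 1 : ℕ) : ℝ) * w ≤ b - a := by
      rw [← hnw]; exact mul_le_mul_of_nonneg_right hkn hw0
    rw [← intervalIntegral.integral_sub (Continuous.intervalIntegrable (by fun_prop) _ _)
      (Continuous.intervalIntegrable (by fun_prop) _ _)]
    refine (intervalIntegral.norm_integral_le_of_norm_le_const
      (C := ε / (b - a + 1)) fun s hs => ?_).trans (le_of_eq ?_)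
    · rw [Set.uIoc_of_le (by linarith)] at hs
      rw [← dist_eq_norm]
      refine (H _ ⟨⟨by linarith [hs.1], by linarith [hs.2]⟩, ⟨by linarith, by linarith⟩,
        ⟨by linarith, by linarith⟩⟩ _ ⟨⟨by linarith [hs.1], by linarith [hs.2]⟩,
        ⟨by linarith [hs.1], by linarith [hs.2]⟩, ⟨by linarith [hs.1], by linarith [hs.2]⟩⟩ ?_).le
      simp only [Prod.dist_eq, dist_self, Real.dist_eq]
      refine max_lt hδ (max_lt ?_ ?_) <;> rw [abs_lt] <;> constructor <;>
        linarith [hs.1, hs.2]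
    · rw [hk1]
      congr 1
      rw [show a + (k * w + w) - (a + k * w) = w by ring, abs_of_nonneg hw0]
  rw [hdiag, dist_eq_norm, ← Finset.sum_sub_distrib]
  calc _ ≤ ∑ k ∈ Finset.range n, ε / (b - a + 1) * w := norm_sum_le_of_le _ hcell
    _ = ε * ((b - a) / (b - a + 1)) := by
        rw [Finset.sum_const, Finset.card_range, nsmul_eq_mul, ← hnw]; ring
    _ < ε * 1 := by
        apply mul_lt_mul_of_pos_left _ hε
        rw [div_lt_one (by linarith)]; linarith
    _ = ε := mul_one ε

/-- Left-endpoint Riemann sums over equal partitions converge to the integral. -/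
theorem tendsto_riemannSum_equal_partition {g : ℝ → ℝ} (hg : Continuous g) {a b : ℝ}
    (hab : a ≤ b) :
    Tendsto (fun n : ℕ => ∑ k ∈ Finset.range n, g (a + k * ((b - a) / n)) * ((b - a) / n))
      atTop (𝓝 (∫ s in a..b, g s)) := by
  refine (tendsto_sum_integral_equal_partition (h := fun p => g p.2.1) (by fun_prop) hab).congr
    fun n => Finset.sum_congr rfl fun k _ => ?_
  simp only [intervalIntegral.integral_const, smul_eq_mul]
  push_cast
  ring

/-! ### Discrete integration by parts -/

/-- Discrete integration by parts along a continuous path `z`: if `v` solves the adjoint equation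
`v' = -Fᵀ v`, then the Riemann–Stieltjes sums of `v` against the noise part
`z(s) - z(0) - ∫₀ˢ F z` of the path converge to `v(t) · z(t) - v(0) · z(0)`. -/
theorem tendsto_adjoint_stieltjesSum {ι : Type*} [Fintype ι] {F : ℝ → Matrix ι ι ℝ}
    (hF : Continuous F) {v z y : ℝ → ι → ℝ} (hv : ∀ s, HasDerivAt v (-((F s)ᵀ *ᵥ v s)) s)
    (hz : Continuous z)
    (hy : ∀ s, 0 ≤ s → y s = z s - z 0 - ∫ r in (0 : ℝ)..s, F r *ᵥ z r) {t : ℝ} (ht : 0 ≤ t) :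
    Tendsto (fun n : ℕ => ∑ k ∈ Finset.range n,
      v (k * (t / n)) ⬝ᵥ (y ((k + 1 : ℕ) * (t / n)) - y (k * (t / n))))
      atTop (𝓝 (v t ⬝ᵥ z t - v 0 ⬝ᵥ z 0)) := by
  have hvc : Continuous v := continuous_iff_continuousAt.mpr fun s => (hv s).continuousAt
  have hFz : Continuous fun r => F r *ᵥ z r := hF.matrix_mulVec hz
  have hFv : Continuous fun r => (F r)ᵀ *ᵥ v r := hF.matrix_transpose.matrix_mulVec hvc
  have hdot : ∀ (x : ι → ℝ) (f : ℝ → ι → ℝ), Continuous f → ∀ p q : ℝ,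
      x ⬝ᵥ (∫ s in p..q, f s) = ∫ s in p..q, x ⬝ᵥ f s := by
    intro x f hf p q
    let L : (ι → ℝ) →L[ℝ] ℝ := (dotProductBilin ℝ ℝ x).toContinuousLinearMap
    exact (L.intervalIntegral_comp_comm (hf.intervalIntegrable p q)).symm
  -- The integrand vanishes on the diagonal, so the sum of its cell integrals tends to zero.
  have hlim := tendsto_sum_integral_equal_partition
    (h := fun p => ((F p.1)ᵀ *ᵥ v p.1) ⬝ᵥ z p.2.2 - v p.2.1 ⬝ᵥ (F p.1 *ᵥ z p.1))
    (((hFv.comp continuous_fst).dotProduct (hz.comp (by fun_prop))).sub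
      ((hvc.comp (by fun_prop)).dotProduct (hFz.comp continuous_fst))) ht
  have hzero : ∀ s, ((F s)ᵀ *ᵥ v s) ⬝ᵥ z s - v s ⬝ᵥ (F s *ᵥ z s) = 0 := fun s => by
    rw [Matrix.mulVec_transpose, ← Matrix.dotProduct_mulVec, sub_self]
  simp only [hzero, intervalIntegral.integral_zero] at hlim
  have := (tendsto_const_nhds (x := v t ⬝ᵥ z t - v 0 ⬝ᵥ z 0)).add hlim
  rw [add_zero] at this
  refine this.congr' ?_
  filter_upwards [eventually_gt_atTop 0] with n hn
  have hn' : (n : ℝ) ≠ 0 := by positivity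
  simp only [sub_zero, zero_add]
  set w := t / n with hw
  have hw0 : 0 ≤ w := by positivity
  have htel : v t ⬝ᵥ z t - v 0 ⬝ᵥ z 0 = ∑ k ∈ Finset.range n,
      (v ((k + 1 : ℕ) * w) ⬝ᵥ z ((k + 1 : ℕ) * w) - v (k * w) ⬝ᵥ z (k * w)) := by
    rw [Finset.sum_range_sub (fun k : ℕ => v (k * w) ⬝ᵥ z (k * w))]
    simp [hw, mul_div_cancel₀ _ hn']
  rw [htel, ← Finset.sum_add_distrib]
  refine Finset.sum_congr rfl fun k _ => ?_
  set p := (k : ℝ) * w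
  set q := ((k + 1 : ℕ) : ℝ) * w
  have hyd : y q - y p = z q - z p - ∫ r in p..q, F r *ᵥ z r := by
    rw [hy q (by positivity), hy p (by positivity),
      ← intervalIntegral.integral_interval_sub_left (hFz.intervalIntegrable 0 q)
        (hFz.intervalIntegrable 0 p)]
    abel
  have hvd : ∫ s in p..q, ((F s)ᵀ *ᵥ v s) ⬝ᵥ z q = v p ⬝ᵥ z q - v q ⬝ᵥ z q := by
    have h1 : ∫ s in p..q, -((F s)ᵀ *ᵥ v s) = v q - v p :=
      intervalIntegral.integral_eq_sub_of_hasDerivAt (fun s _ => hv s)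
        (hFv.neg.intervalIntegrable _ _)
    have h2 := hdot (z q) _ hFv p q
    simp_rw [dotProduct_comm (z q)] at h2
    rw [← h2, ← sub_dotProduct, ← neg_sub (v q), ← h1, intervalIntegral.integral_neg, neg_neg]
  rw [intervalIntegral.integral_sub, hvd, ← hdot _ _ hFz, hyd, dotProduct_sub, dotProduct_sub]
  · ring
  · exact (hFv.dotProduct continuous_const).intervalIntegrable _ _
  · exact (continuous_const.dotProduct hFz).intervalIntegrable _ _

/-! ### Weighted sums of Brownian increments -/

section Stochastic

variable {Ω : Type*} [MeasurableSpace Ω] {P : Measure Ω}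

theorem charFun_map_sum_brownian_increments {X : ℝ≥0 → Ω → ℝ} (hX : IsBrownianReal X P)
    {τ : ℕ → ℝ≥0} (hτ : Monotone τ) (c : ℕ → ℝ) (n : ℕ) :
    charFun (P.map fun ω => ∑ m ∈ Finset.range n, c m * (X (τ (m + 1)) ω - X (τ m) ω)) 1 =
      Complex.exp (-((∑ m ∈ Finset.range n, c m ^ 2 * (τ (m + 1) - τ m : ℝ) : ℝ) : ℂ) / 2) := by
  have hind : iIndepFun (fun m ω => c m * (X (τ (m + 1)) ω - X (τ m) ω)) P :=
    (hX.hasIndepIncrements.nat hτ).comp (fun m x => c m * x) fun m => measurable_const_mul _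
  have hmeas : ∀ m, AEMeasurable (fun ω => c m * (X (τ (m + 1)) ω - X (τ m) ω)) P := fun m =>
    ((hX.aemeasurable _).sub (hX.aemeasurable _)).const_mul _
  rw [(hind.restrict _).charFun_map_fun_finsetSum_eq_prod fun m _ => hmeas m, Finset.prod_apply]
  have hone : ∀ m, charFun (P.map fun ω => c m * (X (τ (m + 1)) ω - X (τ m) ω)) 1 =
      Complex.exp (-((c m ^ 2 * (τ (m + 1) - τ m : ℝ) : ℝ) : ℂ) / 2) := by
    intro m
    obtain ⟨σ, hσ, hlaw⟩ : ∃ σ : ℝ≥0, (σ : ℝ) = τ (m + 1) - τ m ∧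
        HasLaw (X (τ (m + 1)) - X (τ m)) (gaussianReal 0 σ) P := by
      refine ⟨_, ?_, hX.hasLaw_sub (τ (m + 1)) (τ m)⟩
      rw [coe_nndist]
      exact abs_of_nonneg (sub_nonneg.mpr (by exact_mod_cast hτ m.le_succ))
    have := charFun_map_mul_comp (μ := P) hlaw.aemeasurable (c m) 1
    simp only [Pi.sub_apply] at this
    rw [this, hlaw.map_eq, charFun_gaussianReal, ← hσ]
    congr 1
    push_cast
    ring
  rw [Finset.prod_congr rfl fun m _ => hone m, ← Complex.exp_sum]
  congr 1
  push_cast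
  rw [neg_div, Finset.sum_div, ← Finset.sum_neg_distrib]
  exact Finset.sum_congr rfl fun m _ => by ring

variable {ι : Type*} [Fintype ι]

theorem charFun_map_sum_wiener_increments {W : ι → ℝ≥0 → Ω → ℝ} (hW : IsStandardWiener W P)
    {τ : ℕ → ℝ≥0} (hτ : Monotone τ) (c : ℕ → ι → ℝ) (n : ℕ) :
    charFun (P.map fun ω => ∑ m ∈ Finset.range n,
        c m ⬝ᵥ fun j => W j (τ (m + 1)) ω - W j (τ m) ω) 1 =
      Complex.exp
        (-((∑ m ∈ Finset.range n, (c m ⬝ᵥ c m) * (τ (m + 1) - τ m : ℝ) : ℝ) : ℂ) / 2) := by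
  have hswap : (fun ω => ∑ m ∈ Finset.range n,
      c m ⬝ᵥ fun j => W j (τ (m + 1)) ω - W j (τ m) ω) =
      fun ω => ∑ j, ∑ m ∈ Finset.range n, c m j * (W j (τ (m + 1)) ω - W j (τ m) ω) := by
    funext ω
    simp only [dotProduct]
    exact Finset.sum_comm
  have hind : iIndepFun
      (fun j ω => ∑ m ∈ Finset.range n, c m j * (W j (τ (m + 1)) ω - W j (τ m) ω)) P :=
    hW.indep.comp (fun j x => ∑ m ∈ Finset.range n, c m j * (x (τ (m + 1)) - x (τ m)))
      fun j => by fun_prop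
  have hmeas : ∀ j, AEMeasurable
      (fun ω => ∑ m ∈ Finset.range n, c m j * (W j (τ (m + 1)) ω - W j (τ m) ω)) P := fun j =>
    Finset.aemeasurable_fun_sum _ fun m _ =>
      (((hW.brownian j).aemeasurable _).sub ((hW.brownian j).aemeasurable _)).const_mul _
  rw [hswap, hind.charFun_map_fun_sum_eq_prod hmeas, Finset.prod_apply]
  rw [Finset.prod_congr rfl fun j _ =>
    charFun_map_sum_brownian_increments (hW.brownian j) hτ (fun m => c m j) n, ← Complex.exp_sum]
  congr 1
  rw [← Finset.sum_div]
  congr 1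
  rw [Finset.sum_neg_distrib]
  norm_cast
  rw [Finset.sum_comm]
  congr 1
  refine Finset.sum_congr rfl fun m _ => ?_
  rw [dotProduct, Finset.sum_mul]
  exact Finset.sum_congr rfl fun j _ => by ring

/-- A weighted sum of increments of a Wiener process is a centred Gaussian variable independent of
any variable `ξ` independent of the process; this is expressed through the joint characteristic
function. -/
theorem integral_exp_mul_exp_wiener_increments [IsProbabilityMeasure P]
    {E : Type*} [NormedAddCommGroup E] [InnerProductSpace ℝ E] [MeasurableSpace E] [BorelSpace E]
    [SecondCountableTopology E]
    {W : ι → ℝ≥0 → Ω → ℝ} (hW : IsStandardWiener W P) {ξ : Ω → E} (hξ : AEMeasurable ξ P)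
    (hind : IndepFun ξ (fun ω i t => W i t ω) P) (w : E)
    {τ : ℕ → ℝ≥0} (hτ : Monotone τ) (c : ℕ → ι → ℝ) (n : ℕ) :
    ∫ ω, Complex.exp ((inner ℝ (ξ ω) w : ℝ) * Complex.I) * Complex.exp (((∑ m ∈ Finset.range n,
        c m ⬝ᵥ fun j => W j (τ (m + 1)) ω - W j (τ m) ω : ℝ) : ℂ) * Complex.I) ∂P =
      charFun (P.map ξ) w * Complex.exp
        (-((∑ m ∈ Finset.range n, (c m ⬝ᵥ c m) * (τ (m + 1) - τ m : ℝ) : ℝ) : ℂ) / 2) := by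
  have hmeas : AEMeasurable (fun ω => ∑ m ∈ Finset.range n,
      c m ⬝ᵥ fun j => W j (τ (m + 1)) ω - W j (τ m) ω) P :=
    Finset.aemeasurable_fun_sum _ fun m _ => Finset.aemeasurable_fun_sum _ fun j _ =>
      (((hW.brownian j).aemeasurable _).sub ((hW.brownian j).aemeasurable _)).const_mul _
  have hind' : IndepFun ξ (fun ω => ∑ m ∈ Finset.range n,
      c m ⬝ᵥ fun j => W j (τ (m + 1)) ω - W j (τ m) ω) P :=
    hind.comp (φ := id) (ψ := fun x : ι → ℝ≥0 → ℝ => ∑ m ∈ Finset.range n,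
      c m ⬝ᵥ fun j => x j (τ (m + 1)) - x j (τ m)) measurable_id (by
        simp only [dotProduct]; fun_prop)
  rw [hind'.integral_fun_comp_mul_comp hξ hmeas
    (f := fun x => Complex.exp ((inner ℝ x w : ℝ) * Complex.I))
    (g := fun x : ℝ => Complex.exp ((x : ℂ) * Complex.I))
    (Measurable.aestronglyMeasurable (by fun_prop))
    (Measurable.aestronglyMeasurable (by fun_prop)),
    ← charFun_map_sum_wiener_increments hW hτ c n, charFun_apply, charFun_apply_real,
    integral_map hξ (Measurable.aestronglyMeasurable (by fun_prop)),
    integral_map hmeas (Measurable.aestronglyMeasurable (by fun_prop))]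
  simp

/-! ### The joint characteristic function of a linear stochastic differential equation -/

/-- Finitely many sequences converging in measure converge almost everywhere along a common
subsequence. -/
theorem exists_common_subseq_tendsto_ae {E κ : Type*} [PseudoEMetricSpace E]
    {f : κ → ℕ → Ω → E} {g : κ → Ω → E} (s : Finset κ)
    (h : ∀ k ∈ s, TendstoInMeasure P (f k) atTop (g k)) :
    ∃ φ : ℕ → ℕ, StrictMono φ ∧
      ∀ᵐ ω ∂P, ∀ k ∈ s, Tendsto (fun n => f k (φ n) ω) atTop (𝓝 (g k ω)) := by
  classical
  induction s using Finset.induction_on with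
  | empty => exact ⟨id, strictMono_id, by simp⟩
  | insert a s _ ih =>
    obtain ⟨φ, hφ, hae⟩ := ih fun k hk => h k (Finset.mem_insert_of_mem hk)
    obtain ⟨ψ, hψ, hae'⟩ :=
      ((h a (Finset.mem_insert_self a s)).comp hφ.tendsto_atTop).exists_seq_tendsto_ae
    refine ⟨φ ∘ ψ, hφ.comp hψ, ?_⟩
    filter_upwards [hae, hae'] with ω hω hω' k hk
    rcases Finset.mem_insert.mp hk with rfl | hk
    · exact hω'
    · exact (hω k hk).comp hψ.tendsto_atTop

theorem sum_range_mul_eq_sum_sum {α : Type*} [AddCommMonoid α] (f : ℕ → ℕ → α) (N n : ℕ) :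
    ∑ m ∈ Finset.range (N * n), f m (m / n) =
      ∑ k ∈ Finset.range N, ∑ j ∈ Finset.range n, f (k * n + j) k := by
  induction N with
  | zero => simp
  | succ N ih =>
    rw [Nat.succ_mul, Finset.sum_range_add, ih, Finset.sum_range_succ]
    congr 1
    refine Finset.sum_congr rfl fun j hj => ?_
    have hj := Finset.mem_range.mp hj
    rw [mul_comm N n, Nat.mul_add_div (by omega), Nat.div_eq_of_lt hj, add_zero]

end Stochastic

/-- The Riemann sum over `[0, k r]` with `k n` cells uses the grid of mesh `r / n`, for every `k`:
the grids for different `k` are nested, which makes the sums over different intervals comparable. -/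
theorem wienerSum_mul_mul {Ω ι : Type*} [Fintype ι] (G : ℝ → Matrix ι ι ℝ)
    (W : ι → ℝ≥0 → Ω → ℝ) (r : ℝ≥0) (k n : ℕ) (ω : Ω) :
    wienerSum G W (k * r) (k * n) ω = ∑ j ∈ Finset.range (k * n), WithLp.toLp 2
      (G (j * (r / n : ℝ≥0)) *ᵥ
        fun i => W i ((j + 1 : ℕ) * (r / n)) ω - W i (j * (r / n)) ω) := by
  unfold wienerSum
  refine Finset.sum_congr rfl fun j hj => ?_
  have hkn : k * n ≠ 0 := by
    have := Finset.mem_range.mp hj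
    omega
  have hk : (k : ℝ≥0) ≠ 0 := by exact_mod_cast left_ne_zero_of_mul hkn
  have hn : (n : ℝ≥0) ≠ 0 := by exact_mod_cast right_ne_zero_of_mul hkn
  have e : ∀ x : ℝ≥0, x * (k * r) / ((k * n : ℕ) : ℝ≥0) = x * (r / n) := fun x => by
    push_cast
    field_simp
  have e' : (j : ℝ) * ((k * r : ℝ≥0) : ℝ) / ((k * n : ℕ) : ℝ) = j * ((r / n : ℝ≥0) : ℝ) := by
    have := congrArg ((↑) : ℝ≥0 → ℝ) (e j)
    exact_mod_cast this
  rw [e', e, e]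
  push_cast
  rfl

section LinearSDE

variable {Ω : Type*} [MeasurableSpace Ω] {P : Measure Ω} {ι : Type*} [Fintype ι]

theorem IsStandardWiener.aemeasurable_wienerSum {W : ι → ℝ≥0 → Ω → ℝ} (hW : IsStandardWiener W P)
    (G : ℝ → Matrix ι ι ℝ) (t : ℝ≥0) (n : ℕ) : AEMeasurable (wienerSum G W t n) P := by
  unfold wienerSum
  refine Finset.aemeasurable_fun_sum _ fun k _ => ?_
  refine (WithLp.measurable_toLp 2 _).comp_aemeasurable ?_
  refine (Continuous.measurable (f := fun x : ι → ℝ => G ((k : ℝ) * t / n) *ᵥ x)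
    (by fun_prop)).comp_aemeasurable ?_
  exact aemeasurable_pi_lambda _ fun j =>
    ((hW.brownian j).aemeasurable _).sub ((hW.brownian j).aemeasurable _)

/-- Joint characteristic function of a variable `ξ` independent of the Wiener process and a
weighted sum of increments, over `N` cells of length `r`, of the process `Y = ∫ G dW`. -/
theorem integral_exp_mul_exp_stieltjesSum [IsProbabilityMeasure P]
    {E : Type*} [NormedAddCommGroup E] [InnerProductSpace ℝ E] [MeasurableSpace E] [BorelSpace E]
    [SecondCountableTopology E] {G : ℝ → Matrix ι ι ℝ} (hG : Continuous G)
    {W : ι → ℝ≥0 → Ω → ℝ} (hW : IsStandardWiener W P) {ξ : Ω → E} (hξ : AEMeasurable ξ P)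
    (hind : IndepFun ξ (fun ω i t => W i t ω) P) (w : E)
    {Y : ℝ≥0 → Ω → EuclideanSpace ℝ ι} (hY : ∀ t, IsWienerIntegral G W t (Y t) P)
    (hY0 : ∀ ω, Y 0 ω = 0) (v : ℝ → ι → ℝ) (r : ℝ≥0) (N : ℕ) :
    ∫ ω, Complex.exp ((inner ℝ (ξ ω) w : ℝ) * Complex.I) *
        Complex.exp (((∑ k ∈ Finset.range N, v (k * r) ⬝ᵥ
          ((Y ((k + 1 : ℕ) * r) ω).ofLp - (Y (k * r) ω).ofLp) : ℝ) : ℂ) * Complex.I) ∂P =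
      charFun (P.map ξ) w * Complex.exp (-((∑ k ∈ Finset.range N,
        ∫ s in (k * r : ℝ)..((k + 1 : ℕ) * r : ℝ),
          ((G s)ᵀ *ᵥ v (k * r)) ⬝ᵥ ((G s)ᵀ *ᵥ v (k * r)) : ℝ) : ℂ) / 2) := by
  have hconv : ∀ k ∈ Finset.range (N + 1), TendstoInMeasure P
      (fun n => wienerSum G W (k * r) (k * n)) atTop (Y (k * r)) := by
    intro k _
    -- For `k = 0` the number of cells `k n` does not tend to infinity, but both sides vanish.
    rcases Nat.eq_zero_or_pos k with rfl | hk
    · have : Y ((0 : ℕ) * r) = 0 := by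
        funext ω
        simpa using hY0 ω
      rw [this]
      refine tendstoInMeasure_of_tendsto_ae
        (fun n => (hW.aemeasurable_wienerSum G _ _).aestronglyMeasurable) (ae_of_all _ fun ω => ?_)
      simp [wienerSum]
    · exact (hY (k * r)).comp (Filter.tendsto_id.const_mul_atTop' hk)
  -- Almost sure convergence at all grid points at once allows passing to the limit in sums.
  obtain ⟨φ, hφ, hae⟩ := exists_common_subseq_tendsto_ae _ hconv
  -- The approximations of the increments of `Y` on the grid of mesh `r / n`.
  let S : ℕ → Ω → ℝ := fun n ω => ∑ k ∈ Finset.range N, v (k * r) ⬝ᵥ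
    ((wienerSum G W ((k + 1 : ℕ) * r) ((k + 1) * n) ω).ofLp -
      (wienerSum G W (k * r) (k * n) ω).ofLp)
  have hdotc : ∀ x : ι → ℝ, Continuous fun y : ι → ℝ => x ⬝ᵥ y := fun x =>
    continuous_const.dotProduct continuous_id
  have hSlim : ∀ᵐ ω ∂P, Tendsto (fun n => S (φ n) ω) atTop
      (𝓝 (∑ k ∈ Finset.range N, v (k * r) ⬝ᵥ
          ((Y ((k + 1 : ℕ) * r) ω).ofLp - (Y (k * r) ω).ofLp))) := by
    filter_upwards [hae] with ω hω
    refine tendsto_finsetSum _ fun k hk => ?_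
    have hk := Finset.mem_range.mp hk
    have h1 := hω (k + 1) (Finset.mem_range.mpr (by omega))
    have h2 := hω k (Finset.mem_range.mpr (by omega))
    have hc := PiLp.continuous_ofLp 2 (fun _ : ι => ℝ)
    exact ((hdotc _).tendsto _).comp (((hc.tendsto _).comp h1).sub ((hc.tendsto _).comp h2))
  have hSmeas : ∀ n, AEMeasurable (S n) P := fun n =>
    Finset.aemeasurable_fun_sum _ fun k _ => (hdotc _).measurable.comp_aemeasurable
      (((WithLp.measurable_ofLp 2 _).comp_aemeasurable (hW.aemeasurable_wienerSum G _ _)).sub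
        ((WithLp.measurable_ofLp 2 _).comp_aemeasurable (hW.aemeasurable_wienerSum G _ _)))
  have hS : ∀ n ω, S n ω = ∑ m ∈ Finset.range (N * n),
      ((G (m * (r / n : ℝ≥0)))ᵀ *ᵥ v ((m / n : ℕ) * r)) ⬝ᵥ
        fun i => W i ((m + 1 : ℕ) * (r / n)) ω - W i (m * (r / n)) ω := by
    intro n ω
    rw [sum_range_mul_eq_sum_sum (fun m k => ((G (m * (r / n : ℝ≥0)))ᵀ *ᵥ v (k * r)) ⬝ᵥ
        fun i => W i ((m + 1 : ℕ) * (r / n)) ω - W i (m * (r / n)) ω)]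
    refine Finset.sum_congr rfl fun k _ => ?_
    rw [wienerSum_mul_mul, wienerSum_mul_mul, Nat.succ_mul, Finset.sum_range_add,
      ← WithLp.ofLp_sub, add_sub_cancel_left, WithLp.ofLp_sum, dotProduct_sum]
    refine Finset.sum_congr rfl fun j _ => ?_
    rw [Matrix.mulVec_transpose, ← Matrix.dotProduct_mulVec]
  have hlhs : Tendsto (fun n => ∫ ω, Complex.exp ((inner ℝ (ξ ω) w : ℝ) * Complex.I) *
      Complex.exp ((S (φ n) ω : ℂ) * Complex.I) ∂P) atTop
      (𝓝 (∫ ω, Complex.exp ((inner ℝ (ξ ω) w : ℝ) * Complex.I) *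
        Complex.exp (((∑ k ∈ Finset.range N, v (k * r) ⬝ᵥ
          ((Y ((k + 1 : ℕ) * r) ω).ofLp - (Y (k * r) ω).ofLp) : ℝ) : ℂ) * Complex.I) ∂P)) := by
    refine tendsto_integral_of_dominated_convergence (fun _ => 1) (fun n => ?_)
      (integrable_const _) (fun n => ae_of_all _ fun ω => ?_) ?_
    · refine AEStronglyMeasurable.mul ?_ ?_
      · exact (Measurable.aestronglyMeasurable (f := fun x => Complex.exp ((inner ℝ x w : ℝ) *
          Complex.I)) (by fun_prop)).comp_aemeasurable hξ
      · exact (Measurable.aestronglyMeasurable (f := fun x : ℝ => Complex.exp ((x : ℂ) *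
          Complex.I)) (by fun_prop)).comp_aemeasurable (hSmeas _)
    · rw [norm_mul, Complex.norm_exp_ofReal_mul_I, Complex.norm_exp_ofReal_mul_I, mul_one]
    · filter_upwards [hSlim] with ω hω
      exact tendsto_const_nhds.mul
        (((Continuous.tendsto (f := fun x : ℝ => Complex.exp ((x : ℂ) * Complex.I))
          (by fun_prop) _)).comp hω)
  have hgc : ∀ x : ι → ℝ, Continuous fun s => ((G s)ᵀ *ᵥ x) ⬝ᵥ ((G s)ᵀ *ᵥ x) := fun x =>
    (hG.matrix_transpose.matrix_mulVec continuous_const).dotProduct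
      (hG.matrix_transpose.matrix_mulVec continuous_const)
  -- On each of the `N` cells the variances form a Riemann sum with `n` terms.
  have hrhs : Tendsto (fun n : ℕ => ∑ m ∈ Finset.range (N * n),
      (((G (m * (r / n : ℝ≥0)))ᵀ *ᵥ v ((m / n : ℕ) * r)) ⬝ᵥ
        ((G (m * (r / n : ℝ≥0)))ᵀ *ᵥ v ((m / n : ℕ) * r))) *
        ((((m + 1 : ℕ) * (r / n) : ℝ≥0) : ℝ) - ((m * (r / n) : ℝ≥0) : ℝ))) atTop
      (𝓝 (∑ k ∈ Finset.range N, ∫ s in (k * r : ℝ)..((k + 1 : ℕ) * r : ℝ),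
          ((G s)ᵀ *ᵥ v (k * r)) ⬝ᵥ ((G s)ᵀ *ᵥ v (k * r)))) := by
    have hcell : ∀ k ∈ Finset.range N, _ := fun k _ =>
      tendsto_riemannSum_equal_partition (hgc (v (k * r))) (a := k * r) (b := (k + 1 : ℕ) * r)
        (by push_cast; nlinarith [r.coe_nonneg])
    refine (tendsto_finsetSum _ hcell).congr' ?_
    filter_upwards [eventually_gt_atTop 0] with n hn
    have hn' : (n : ℝ) ≠ 0 := by positivity
    rw [sum_range_mul_eq_sum_sum (fun m k =>
      (((G (m * (r / n : ℝ≥0)))ᵀ *ᵥ v (k * r)) ⬝ᵥ ((G (m * (r / n : ℝ≥0)))ᵀ *ᵥ v (k * r))) *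
        ((((m + 1 : ℕ) * (r / n) : ℝ≥0) : ℝ) - ((m * (r / n) : ℝ≥0) : ℝ)))]
    refine Finset.sum_congr rfl fun k _ => Finset.sum_congr rfl fun j _ => ?_
    have e1 : (((k + 1 : ℕ) : ℝ) * r - k * r) / n = r / n := by push_cast; ring
    have e2 : ((k * n + j : ℕ) : ℝ) * ((r / n : ℝ≥0) : ℝ) = k * r + j * (r / n) := by
      push_cast
      field_simp
    rw [e1, e2]
    congr 1
    push_cast
    ring
  have hmono : ∀ n : ℕ, Monotone fun m : ℕ => (m : ℝ≥0) * (r / n) := fun n a b hab => by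
    dsimp only
    gcongr
  refine tendsto_nhds_unique hlhs ?_
  have hlim := ((Continuous.tendsto (f := fun x : ℝ => charFun (P.map ξ) w *
    Complex.exp (-(x : ℂ) / 2)) (by fun_prop) _).comp hrhs).comp hφ.tendsto_atTop
  refine hlim.congr fun n => ?_
  simp only [Function.comp_apply, hS]
  exact (integral_exp_mul_exp_wiener_increments hW hξ hind w (hmono (φ n)) _ _).symm

/-- For a solution `Z` of `dZ = F Z dt + G dW` and a solution `v` of the adjoint equation
`v' = -Fᵀ v`, the variable `v(t) · Z_t - v(0) · Z_0` is a centred Gaussian variable with variance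
`∫₀ᵗ |Gᵀ v|²` independent of `Z_0`. -/
theorem IsLinearSDESolution.integral_exp_mul_exp_adjoint [IsProbabilityMeasure P]
    {F G : ℝ → Matrix ι ι ℝ} (hF : Continuous F) (hG : Continuous G)
    {W : ι → ℝ≥0 → Ω → ℝ} {Z : ℝ≥0 → Ω → EuclideanSpace ℝ ι}
    (h : IsLinearSDESolution F G W Z P) {v : ℝ → ι → ℝ}
    (hv : ∀ s, HasDerivAt v (-((F s)ᵀ *ᵥ v s)) s) (w : EuclideanSpace ℝ ι) (t : ℝ≥0) :
    ∫ ω, Complex.exp ((inner ℝ (Z 0 ω) w : ℝ) * Complex.I) *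
        Complex.exp (((v t ⬝ᵥ (Z t ω).ofLp - v 0 ⬝ᵥ (Z 0 ω).ofLp : ℝ) : ℂ) * Complex.I) ∂P =
      charFun (P.map (Z 0)) w * Complex.exp (-((∫ s in (0 : ℝ)..t,
        ((G s)ᵀ *ᵥ v s) ⬝ᵥ ((G s)ᵀ *ᵥ v s) : ℝ) : ℂ) / 2) := by
  have hvc : Continuous v := continuous_iff_continuousAt.mpr fun s => (hv s).continuousAt
  let Y : ℝ≥0 → Ω → EuclideanSpace ℝ ι := fun t ω => Z t ω - Z 0 ω -
    ∫ s in (0 : ℝ)..t, WithLp.toLp 2 (F s *ᵥ (Z s.toNNReal ω).ofLp)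
  -- The Riemann–Stieltjes sum of `v` against the noise part `Y`, over `N` cells.
  let L : ℕ → Ω → ℝ := fun N ω => ∑ k ∈ Finset.range N, v (k * (t / N : ℝ≥0)) ⬝ᵥ
    ((Y ((k + 1 : ℕ) * (t / N)) ω).ofLp - (Y (k * (t / N)) ω).ofLp)
  have hYmeas : ∀ t, AEMeasurable (Y t) P := fun t =>
    (h.equation t).aemeasurable fun n => h.wiener.aemeasurable_wienerSum G t n
  have hLmeas : ∀ N, AEMeasurable (L N) P := fun N =>
    Finset.aemeasurable_fun_sum _ fun k _ => (Continuous.measurable (f := fun y : ι → ℝ => _ ⬝ᵥ y)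
      (continuous_const.dotProduct continuous_id)).comp_aemeasurable
      (((WithLp.measurable_ofLp 2 _).comp_aemeasurable (hYmeas _)).sub
        ((WithLp.measurable_ofLp 2 _).comp_aemeasurable (hYmeas _)))
  have hLlim : ∀ᵐ ω ∂P, Tendsto (fun N => L N ω) atTop
      (𝓝 (v t ⬝ᵥ (Z t ω).ofLp - v 0 ⬝ᵥ (Z 0 ω).ofLp)) := by
    filter_upwards [h.continuous] with ω hω
    have hz : Continuous fun s : ℝ => (Z s.toNNReal ω).ofLp :=
      (PiLp.continuous_ofLp 2 (fun _ : ι => ℝ)).comp (hω.comp continuous_real_toNNReal)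
    have key := tendsto_adjoint_stieltjesSum hF hv hz (y := fun s => (Y s.toNNReal ω).ofLp)
      (fun s hs => ?_) t.coe_nonneg
    · simp only [Real.toNNReal_coe, Real.toNNReal_zero] at key
      refine key.congr fun N => Finset.sum_congr rfl fun k _ => ?_
      have e : ∀ x : ℕ, ((x : ℝ) * (t / N)).toNNReal = x * (t / N) := fun x => by
        rw [← Real.toNNReal_coe (r := x * (t / N))]
        push_cast
        rfl
      rw [e, e]
      push_cast
      rfl
    · simp only [Y, WithLp.ofLp_sub, Real.coe_toNNReal s hs, Real.toNNReal_zero]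
      congr 1
      exact ((PiLp.continuousLinearEquiv 2 ℝ (fun _ : ι => ℝ)).toContinuousLinearMap
        |>.intervalIntegral_comp_comm (Continuous.intervalIntegrable
          ((PiLp.continuous_toLp 2 _).comp (hF.matrix_mulVec hz)) _ _)).symm
  have hlhs : Tendsto (fun N => ∫ ω, Complex.exp ((inner ℝ (Z 0 ω) w : ℝ) * Complex.I) *
      Complex.exp ((L N ω : ℂ) * Complex.I) ∂P) atTop
      (𝓝 (∫ ω, Complex.exp ((inner ℝ (Z 0 ω) w : ℝ) * Complex.I) *
        Complex.exp (((v t ⬝ᵥ (Z t ω).ofLp - v 0 ⬝ᵥ (Z 0 ω).ofLp : ℝ) : ℂ) * Complex.I) ∂P)) := by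
    refine tendsto_integral_of_dominated_convergence (fun _ => 1) (fun n => ?_)
      (integrable_const _) (fun n => ae_of_all _ fun ω => ?_) ?_
    · refine AEStronglyMeasurable.mul ?_ ?_
      · exact (Measurable.aestronglyMeasurable (f := fun x => Complex.exp ((inner ℝ x w : ℝ) *
          Complex.I)) (by fun_prop)).comp_aemeasurable (h.aemeasurable 0)
      · exact (Measurable.aestronglyMeasurable (f := fun x : ℝ => Complex.exp ((x : ℂ) *
          Complex.I)) (by fun_prop)).comp_aemeasurable (hLmeas _)
    · rw [norm_mul, Complex.norm_exp_ofReal_mul_I, Complex.norm_exp_ofReal_mul_I, mul_one]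
    · filter_upwards [hLlim] with ω hω
      exact tendsto_const_nhds.mul
        (((Continuous.tendsto (f := fun x : ℝ => Complex.exp ((x : ℂ) * Complex.I))
          (by fun_prop) _)).comp hω)
  have hGv : Continuous fun p : ℝ × ℝ × ℝ => (G p.1)ᵀ *ᵥ v p.2.1 :=
    (hG.matrix_transpose.comp continuous_fst).matrix_mulVec (hvc.comp (by fun_prop))
  have hrhs := tendsto_sum_integral_equal_partition (hGv.dotProduct hGv) t.coe_nonneg
  refine tendsto_nhds_unique hlhs ?_
  refine ((Continuous.tendsto (f := fun x : ℝ => charFun (P.map (Z 0)) w *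
    Complex.exp (-(x : ℂ) / 2)) (by fun_prop) _).comp hrhs).congr fun N => ?_
  have hsum := integral_exp_mul_exp_stieltjesSum hG h.wiener (h.aemeasurable 0) h.indep w
    (Y := Y) h.equation (fun ω => by simp [Y]) v (t / N) N
  rw [hsum]
  simp only [Function.comp_apply, sub_zero, zero_add, NNReal.coe_div, NNReal.coe_natCast]

end LinearSDE

/-! ### The propagator of the drift -/

/-- `p` and `q` are the coefficients of the fundamental solution `p(b) 1 + q(b) N` of
`E' = (c + N) E`, for a matrix `N` with `N² = δ`. The initial values and the derivatives determine
`p` and `q`; their decay when `c ± √δ` have negative real parts and their values for `δ = 0` are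
recorded as further fields. -/
structure IsPropagatorPair (c δ : ℝ) (p q : ℝ → ℝ) : Prop where
  p_zero : p 0 = 1
  q_zero : q 0 = 0
  hasDerivAt_p : ∀ b, HasDerivAt p (c * p b + δ * q b) b
  hasDerivAt_q : ∀ b, HasDerivAt q (c * q b + p b) b
  tendsto_p : c < 0 → δ < c ^ 2 → Tendsto p atTop (𝓝 0)
  tendsto_q : c < 0 → δ < c ^ 2 → Tendsto q atTop (𝓝 0)
  eq_of_critical : δ = 0 → ∀ b, p b = Real.exp (c * b) ∧ q b = b * Real.exp (c * b)

theorem tendsto_exp_mul_atTop_zero {c : ℝ} (hc : c < 0) :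
    Tendsto (fun b => Real.exp (c * b)) atTop (𝓝 0) :=
  Real.tendsto_exp_atBot.comp (tendsto_id.const_mul_atTop_of_neg hc)

theorem hasDerivAt_exp_mul (c b : ℝ) :
    HasDerivAt (fun b => Real.exp (c * b)) (c * Real.exp (c * b)) b := by
  have := ((hasDerivAt_id b).const_mul c).exp
  simpa [mul_comm] using this

/-- The coefficients are hyperbolic, affine or trigonometric functions times `exp (c b)`, according
to the sign of `δ` (overdamping, critical damping, underdamping). -/
theorem exists_isPropagatorPair (c δ : ℝ) : ∃ p q, IsPropagatorPair c δ p q := by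
  rcases lt_trichotomy δ 0 with hδ | rfl | hδ
  · obtain ⟨κ, hκ, hκδ⟩ : ∃ κ : ℝ, κ ≠ 0 ∧ κ ^ 2 = -δ :=
      ⟨√(-δ), (Real.sqrt_pos.mpr (by linarith)).ne', Real.sq_sqrt (by linarith)⟩
    have hlin : ∀ b, HasDerivAt (fun b : ℝ => κ * b) κ b := fun b => by
      simpa using (hasDerivAt_id b).const_mul κ
    have hbdd : ∀ f : ℝ → ℝ, (∀ x, |f x| ≤ 1) → c < 0 →
        Tendsto (fun b => Real.exp (c * b) * f (κ * b)) atTop (𝓝 0) := fun f hf hc =>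
      squeeze_zero_norm (fun b => by
        rw [norm_mul, Real.norm_eq_abs, Real.norm_eq_abs, Real.abs_exp]
        exact mul_le_of_le_one_right (Real.exp_pos _).le (hf _)) (tendsto_exp_mul_atTop_zero hc)
    refine ⟨fun b => Real.exp (c * b) * Real.cos (κ * b),
      fun b => Real.exp (c * b) * Real.sin (κ * b) / κ, by simp, by simp, fun b => ?_, fun b => ?_,
      fun hc _ => hbdd _ Real.abs_cos_le_one hc, fun hc _ => ?_, fun h => absurd h hδ.ne⟩
    · refine ((hasDerivAt_exp_mul c b).mul (hlin b).cos).congr_deriv ?_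
      rw [← neg_neg δ, ← hκδ]
      field_simp
    · refine (((hasDerivAt_exp_mul c b).mul (hlin b).sin).div_const κ).congr_deriv ?_
      field_simp
    · simpa using (hbdd _ Real.abs_sin_le_one hc).div_const κ
  · refine ⟨fun b => Real.exp (c * b), fun b => b * Real.exp (c * b), by simp, by simp, fun b => ?_,
      fun b => ?_, fun hc _ => tendsto_exp_mul_atTop_zero hc, fun hc _ => ?_,
      fun _ b => ⟨rfl, rfl⟩⟩
    · simpa using hasDerivAt_exp_mul c b
    · refine ((hasDerivAt_id b).mul (hasDerivAt_exp_mul c b)).congr_deriv ?_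
      simp only [id]
      ring
    · have h := (Real.tendsto_pow_mul_exp_neg_atTop_nhds_zero 1).comp
        (tendsto_id.const_mul_atTop (neg_pos.mpr hc))
      have h' := h.const_mul (-c)⁻¹
      rw [mul_zero] at h'
      refine h'.congr fun b => ?_
      simp only [Function.comp_apply, id, pow_one, neg_mul, neg_neg]
      have := hc.ne
      field_simp
  · obtain ⟨κ, hκ, hκδ⟩ : ∃ κ : ℝ, 0 < κ ∧ κ ^ 2 = δ :=
      ⟨√δ, Real.sqrt_pos.mpr hδ, Real.sq_sqrt hδ.le⟩
    have hneg : c < 0 → δ < c ^ 2 → c + κ < 0 ∧ c - κ < 0 := fun hc h =>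
      ⟨by nlinarith, by linarith⟩
    refine ⟨fun b => (Real.exp ((c + κ) * b) + Real.exp ((c - κ) * b)) / 2,
      fun b => (Real.exp ((c + κ) * b) - Real.exp ((c - κ) * b)) / (2 * κ), by simp, by simp,
      fun b => ?_, fun b => ?_, fun hc h => ?_, fun hc h => ?_, fun h => absurd h hδ.ne'⟩
    · refine (((hasDerivAt_exp_mul (c + κ) b).add
        (hasDerivAt_exp_mul (c - κ) b)).div_const 2).congr_deriv ?_
      rw [← hκδ]
      field_simp
      ring
    · refine (((hasDerivAt_exp_mul (c + κ) b).sub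
        (hasDerivAt_exp_mul (c - κ) b)).div_const (2 * κ)).congr_deriv ?_
      field_simp
      ring
    · simpa using ((tendsto_exp_mul_atTop_zero (hneg hc h).1).add
        (tendsto_exp_mul_atTop_zero (hneg hc h).2)).div_const 2
    · simpa using ((tendsto_exp_mul_atTop_zero (hneg hc h).1).sub
        (tendsto_exp_mul_atTop_zero (hneg hc h).2)).div_const (2 * κ)

/-- The common `2 × 2` factor of the propagator of the mean: the matrix `p 1 + q N`, where `N` is the
trace-free part of the drift matrix `½ [[-Γ, M⁻¹], [-1, -ν]]`. -/
noncomputable def psldPropagator (Γ M ν p q : ℝ) : Matrix (Fin 2) (Fin 2) ℝ :=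
  !![p + q * ((ν - Γ) / 4), q * (M⁻¹ / 2); q * (-1 / 2), p + q * ((Γ - ν) / 4)]

/-- The `2 × 2` factor of the covariance started at `diag(a, b)`, in terms of the propagator `E`.
As `diag(1, M)` is stationary, the deviation from it evolves as `X ↦ E X Eᵀ`. -/
noncomputable def psldCov (Γ M ν p q a b : ℝ) : Matrix (Fin 2) (Fin 2) ℝ :=
  !![1, 0; 0, M] + psldPropagator Γ M ν p q * !![a - 1, 0; 0, b - M] *
    (psldPropagator Γ M ν p q)ᵀ

theorem blockMatrix_mulVec_apply {d : ℕ} (A : Matrix (Fin 2) (Fin 2) ℝ) (u : Fin 2 × Fin d → ℝ)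
    (i : Fin 2) (k : Fin d) :
    (blockMatrix d A *ᵥ u) (i, k) = A i 0 * u (0, k) + A i 1 * u (1, k) := by
  simp [blockMatrix, Matrix.mulVec, dotProduct, Fintype.sum_prod_type, Fin.sum_univ_two,
    Matrix.one_apply]

theorem blockMatrix_transpose (d : ℕ) (A : Matrix (Fin 2) (Fin 2) ℝ) :
    (blockMatrix d A)ᵀ = blockMatrix d Aᵀ := by
  rw [blockMatrix, ← Matrix.kroneckerMap_transpose, Matrix.transpose_one]
  rfl

theorem blockMatrix_mul (d : ℕ) (A B : Matrix (Fin 2) (Fin 2) ℝ) :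
    blockMatrix d (A * B) = blockMatrix d A * blockMatrix d B := by
  simp [blockMatrix, ← Matrix.mul_kronecker_mul]

theorem blockMatrix_add (d : ℕ) (A B : Matrix (Fin 2) (Fin 2) ℝ) :
    blockMatrix d (A + B) = blockMatrix d A + blockMatrix d B :=
  Matrix.add_kronecker _ _ _

/-- The quadratic form of `diag(a, b) ⊗ I_d`. -/
theorem dotProduct_blockMatrix_diag {d : ℕ} (a b : ℝ) (u : Fin 2 × Fin d → ℝ) :
    u ⬝ᵥ (blockMatrix d !![a, 0; 0, b] *ᵥ u) =
      ∑ k, (a * u (0, k) ^ 2 + b * u (1, k) ^ 2) := by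
  simp only [dotProduct, Fintype.sum_prod_type, Fin.sum_univ_two, ← Finset.sum_add_distrib,
    blockMatrix_mulVec_apply]
  exact Finset.sum_congr rfl fun k _ => by simp; ring

theorem blockMatrix_diag_posSemidef (d : ℕ) {a b : ℝ} (ha : 0 ≤ a) (hb : 0 ≤ b) :
    (blockMatrix d !![a, 0; 0, b]).PosSemidef := by
  refine Matrix.PosSemidef.of_dotProduct_mulVec_nonneg ?_ fun u => ?_
  · rw [Matrix.IsHermitian, Matrix.conjTranspose_eq_transpose_of_trivial, blockMatrix_transpose]
    congr 1
    ext i j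
    fin_cases i <;> fin_cases j <;> rfl
  · rw [star_trivial, dotProduct_blockMatrix_diag]
    exact Finset.sum_nonneg fun k _ => by positivity

theorem psldCov_critical {Γ M ν : ℝ} (hM : 0 < M) (hcrit : (Γ - ν) ^ 2 = 4 * M⁻¹) (B a b : ℝ) :
    psldCov Γ M ν (Real.exp (-(Γ + ν) / 4 * B)) (B * Real.exp (-(Γ + ν) / 4 * B)) a b =
      criticalCov Γ M ν B a b := by
  have hm : M⁻¹ * M = 1 := inv_mul_cancel₀ hM.ne'
  have he : Real.exp (-((Γ + ν) / 2) * B) = Real.exp (-(Γ + ν) / 4 * B) ^ 2 := by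
    rw [← Real.exp_nat_mul]
    congr 1
    push_cast
    ring
  have hX : Real.exp (-(Γ + ν) / 4 * B) ^ 2 * Real.exp ((Γ + ν) / 2 * B) = 1 := by
    rw [← he, ← Real.exp_add, neg_mul, neg_add_cancel, Real.exp_zero]
  unfold psldCov criticalCov psldPropagator
  simp only [he]
  generalize Real.exp (-(Γ + ν) / 4 * B) = e at *
  generalize Real.exp ((Γ + ν) / 2 * B) = X at *
  generalize M⁻¹ = m at *
  obtain ⟨D, rfl⟩ : ∃ D, Γ = ν + D := ⟨Γ - ν, by ring⟩
  have hD : D ^ 2 = 4 * m := by rw [← hcrit]; ring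
  ext i j
  fin_cases i <;> fin_cases j <;>
    simp [Matrix.vecMul, dotProduct, Fin.sum_univ_two]
  · linear_combination -hX + e ^ 2 * B ^ 2 * (a - 1) / 16 * hD - e ^ 2 * B ^ 2 * m / 4 * hm
  · linear_combination -e ^ 2 * (B / 2 + B ^ 2 * D / 8) * hm - e ^ 2 * B ^ 2 * b * D / 32 * hD
  · linear_combination -e ^ 2 * (B / 2 + B ^ 2 * D / 8) * hm - e ^ 2 * B ^ 2 * b * D / 32 * hD
  · linear_combination -M * hX + e ^ 2 * B ^ 2 * (b - M) / 16 * hD - e ^ 2 * B ^ 2 / 4 * hm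

theorem criticalMean_eq {d : ℕ} {Γ M ν : ℝ} (hcrit : (Γ - ν) ^ 2 = 4 * M⁻¹) (B : ℝ)
    (x₀ m₀ : EuclideanSpace ℝ (Fin d)) :
    WithLp.toLp 2 (blockMatrix d (psldPropagator Γ M ν (Real.exp (-(Γ + ν) / 4 * B))
      (B * Real.exp (-(Γ + ν) / 4 * B))) *ᵥ (phasePoint x₀ m₀).ofLp) =
      criticalMean Γ ν B x₀ m₀ := by
  have he : -((ν + Γ) / 4) * B = -(Γ + ν) / 4 * B := by ring
  have hm : M⁻¹ = (Γ - ν) ^ 2 / 4 := by linarith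
  ext ⟨i, k⟩
  simp only [blockMatrix_mulVec_apply, criticalMean, he, psldPropagator, hm, phasePoint]
  fin_cases i <;> simp <;> ring

/-! ### The adjoint equation of phase space Langevin diffusion -/

section Adjoint

variable {d : ℕ} {Γ M ν : ℝ} {p q : ℝ → ℝ}

theorem psldPropagator_one_zero (Γ M ν : ℝ) : psldPropagator Γ M ν 1 0 = 1 := by
  ext i j
  fin_cases i <;> fin_cases j <;> simp [psldPropagator]

/-- The backward propagator applied to a fixed vector solves the adjoint equation. -/
theorem hasDerivAt_adjoint_propagator
    (hpq : IsPropagatorPair (-(Γ + ν) / 4) ((Γ - ν) ^ 2 / 16 - M⁻¹ / 4) p q)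
    {β B : ℝ → ℝ} (hB : ∀ s, HasDerivAt B (β s) s) (T : ℝ) (u : Fin 2 × Fin d → ℝ) (s : ℝ) :
    HasDerivAt (fun s => (blockMatrix d
        (psldPropagator Γ M ν (p (T - B s)) (q (T - B s))))ᵀ *ᵥ u)
      (-((psldDrift d Γ M ν β s)ᵀ *ᵥ ((blockMatrix d
        (psldPropagator Γ M ν (p (T - B s)) (q (T - B s))))ᵀ *ᵥ u))) s := by
  have hb : HasDerivAt (fun s => T - B s) (-β s) s := (hB s).const_sub T
  have hp := (hpq.hasDerivAt_p (T - B s)).comp s hb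
  have hq := (hpq.hasDerivAt_q (T - B s)).comp s hb
  simp only [Function.comp_def] at hp hq
  rw [hasDerivAt_pi]
  rintro ⟨i, k⟩
  simp only [psldDrift, blockMatrix_transpose, Pi.neg_apply, blockMatrix_mulVec_apply,
    Matrix.transpose_apply, Matrix.smul_apply, psldPropagator]
  fin_cases i
  · refine (((hp.add (hq.mul_const _)).mul_const _).add
      ((hq.mul_const _).mul_const _)).congr_deriv ?_
    simp
    ring
  · refine (((hq.mul_const _).mul_const _).add
      ((hp.add (hq.mul_const _)).mul_const _)).congr_deriv ?_
    simp
    ring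

theorem dotProduct_psldDiffusion_transpose_mulVec (hΓ : 0 ≤ Γ) (hM : 0 ≤ M) (hν : 0 ≤ ν)
    {β : ℝ → ℝ} {s : ℝ} (hβ : 0 ≤ β s) (v : Fin 2 × Fin d → ℝ) :
    ((psldDiffusion d Γ M ν β s)ᵀ *ᵥ v) ⬝ᵥ ((psldDiffusion d Γ M ν β s)ᵀ *ᵥ v) =
      ∑ k, (Γ * β s * v (0, k) ^ 2 + M * ν * β s * v (1, k) ^ 2) := by
  simp only [psldDiffusion, blockMatrix_transpose, dotProduct, Fintype.sum_prod_type,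
    Fin.sum_univ_two, ← Finset.sum_add_distrib, blockMatrix_mulVec_apply, Matrix.transpose_apply]
  refine Finset.sum_congr rfl fun k _ => ?_
  have h1 := Real.sq_sqrt (mul_nonneg hΓ hβ)
  have h2 := Real.sq_sqrt (mul_nonneg (mul_nonneg hM hν) hβ)
  simp
  linear_combination v (0, k) ^ 2 * h1 + v (1, k) ^ 2 * h2

/-- Along a solution `v` of the adjoint equation, `v · diag(1, M) v` grows at the rate `|Gᵀ v|²`.
This is the stationarity `F D + D Fᵀ + G Gᵀ = 0` of the covariance `D = diag(1, M)`. -/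
theorem integral_psldDiffusion_adjoint (hΓ : 0 ≤ Γ) (hM : 0 < M) (hν : 0 ≤ ν)
    {β : ℝ → ℝ} (hβc : Continuous β) (hβ : ∀ s, 0 ≤ β s) {v : ℝ → Fin 2 × Fin d → ℝ}
    (hv : ∀ s, HasDerivAt v (-((psldDrift d Γ M ν β s)ᵀ *ᵥ v s)) s) (t : ℝ) :
    ∫ s in (0 : ℝ)..t, ((psldDiffusion d Γ M ν β s)ᵀ *ᵥ v s) ⬝ᵥ
        ((psldDiffusion d Γ M ν β s)ᵀ *ᵥ v s) =
      v t ⬝ᵥ (blockMatrix d !![1, 0; 0, M] *ᵥ v t) -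
        v 0 ⬝ᵥ (blockMatrix d !![1, 0; 0, M] *ᵥ v 0) := by
  have hvc : Continuous v := continuous_iff_continuousAt.mpr fun s => (hv s).continuousAt
  have hvc' : ∀ x, Continuous fun s => v s x := fun x => (continuous_apply x).comp hvc
  simp only [dotProduct_blockMatrix_diag,
    dotProduct_psldDiffusion_transpose_mulVec hΓ hM.le hν (hβ _)]
  refine intervalIntegral.integral_eq_sub_of_hasDerivAt
    (f := fun s => ∑ k, (1 * v s (0, k) ^ 2 + M * v s (1, k) ^ 2)) (fun s _ => ?_)
    (Continuous.intervalIntegrable (by fun_prop) _ _)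
  refine HasDerivAt.fun_sum fun k _ => ?_
  have h := fun x => hasDerivAt_pi.mp (hv s) x
  refine ((((h (0, k)).pow 2).const_mul 1).add (((h (1, k)).pow 2).const_mul M)).congr_deriv ?_
  simp only [psldDrift, blockMatrix_transpose, Pi.neg_apply, blockMatrix_mulVec_apply,
    Matrix.transpose_apply, Matrix.smul_apply]
  simp
  field_simp
  ring

theorem dotProduct_psldCov_mulVec (p q a b : ℝ) (u : Fin 2 × Fin d → ℝ) :
    u ⬝ᵥ (blockMatrix d (psldCov Γ M ν p q a b) *ᵥ u) =
      (u ⬝ᵥ (blockMatrix d !![1, 0; 0, M] *ᵥ u) -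
        ((blockMatrix d (psldPropagator Γ M ν p q))ᵀ *ᵥ u) ⬝ᵥ (blockMatrix d !![1, 0; 0, M] *ᵥ
          ((blockMatrix d (psldPropagator Γ M ν p q))ᵀ *ᵥ u))) +
        ((blockMatrix d (psldPropagator Γ M ν p q))ᵀ *ᵥ u) ⬝ᵥ (blockMatrix d !![a, 0; 0, b] *ᵥ
          ((blockMatrix d (psldPropagator Γ M ν p q))ᵀ *ᵥ u)) := by
  have hX : u ⬝ᵥ (blockMatrix d (psldPropagator Γ M ν p q * !![a - 1, 0; 0, b - M] *
      (psldPropagator Γ M ν p q)ᵀ) *ᵥ u) =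
      ((blockMatrix d (psldPropagator Γ M ν p q))ᵀ *ᵥ u) ⬝ᵥ (blockMatrix d
        !![a - 1, 0; 0, b - M] *ᵥ ((blockMatrix d (psldPropagator Γ M ν p q))ᵀ *ᵥ u)) := by
    rw [blockMatrix_mul, blockMatrix_mul, ← blockMatrix_transpose, ← Matrix.mulVec_mulVec,
      ← Matrix.mulVec_mulVec, Matrix.dotProduct_mulVec, ← Matrix.mulVec_transpose]
  rw [psldCov, blockMatrix_add, Matrix.add_mulVec, dotProduct_add, hX,
    dotProduct_blockMatrix_diag, dotProduct_blockMatrix_diag, dotProduct_blockMatrix_diag,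
    dotProduct_blockMatrix_diag, ← Finset.sum_sub_distrib, ← Finset.sum_add_distrib,
    ← Finset.sum_add_distrib]
  exact Finset.sum_congr rfl fun k _ => by ring

theorem blockMatrix_psldCov_isHermitian (p q a b : ℝ) :
    (blockMatrix d (psldCov Γ M ν p q a b)).IsHermitian := by
  rw [Matrix.IsHermitian, Matrix.conjTranspose_eq_transpose_of_trivial, blockMatrix_transpose]
  have hdiag : ∀ x y : ℝ, (!![x, 0; 0, y] : Matrix (Fin 2) (Fin 2) ℝ)ᵀ = !![x, 0; 0, y] := by
    intro x y
    ext i j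
    fin_cases i <;> fin_cases j <;> rfl
  rw [psldCov, Matrix.transpose_add, Matrix.transpose_mul, Matrix.transpose_mul,
    Matrix.transpose_transpose, hdiag, hdiag, Matrix.mul_assoc]

/-- The variance `∫₀ᵗ |Gᵀ v|²` of the noise in the direction `u` is the quadratic form of the
covariance started at a deterministic point. -/
theorem integral_psldDiffusion_propagator (hΓ : 0 ≤ Γ) (hM : 0 < M) (hν : 0 ≤ ν)
    (hpq : IsPropagatorPair (-(Γ + ν) / 4) ((Γ - ν) ^ 2 / 16 - M⁻¹ / 4) p q)
    {β B : ℝ → ℝ} (hβc : Continuous β) (hβ : ∀ s, 0 ≤ β s) (hB : ∀ s, HasDerivAt B (β s) s)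
    (hB0 : B 0 = 0) (t : ℝ) (u : Fin 2 × Fin d → ℝ) :
    ∫ s in (0 : ℝ)..t,
        ((psldDiffusion d Γ M ν β s)ᵀ *ᵥ ((blockMatrix d
          (psldPropagator Γ M ν (p (B t - B s)) (q (B t - B s))))ᵀ *ᵥ u)) ⬝ᵥ
        ((psldDiffusion d Γ M ν β s)ᵀ *ᵥ ((blockMatrix d
          (psldPropagator Γ M ν (p (B t - B s)) (q (B t - B s))))ᵀ *ᵥ u)) =
      u ⬝ᵥ (blockMatrix d (psldCov Γ M ν (p (B t)) (q (B t)) 0 0) *ᵥ u) := by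
  rw [integral_psldDiffusion_adjoint hΓ hM hν hβc hβ
    (hasDerivAt_adjoint_propagator hpq hB (B t) u), dotProduct_psldCov_mulVec,
    dotProduct_blockMatrix_diag 0 0]
  simp [hpq.p_zero, hpq.q_zero, hB0, psldPropagator_one_zero, blockMatrix]

theorem blockMatrix_psldCov_posSemidef (hΓ : 0 ≤ Γ) (hM : 0 < M) (hν : 0 ≤ ν)
    (hpq : IsPropagatorPair (-(Γ + ν) / 4) ((Γ - ν) ^ 2 / 16 - M⁻¹ / 4) p q)
    {β B : ℝ → ℝ} (hβc : Continuous β) (hβ : ∀ s, 0 ≤ β s) (hB : ∀ s, HasDerivAt B (β s) s)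
    (hB0 : B 0 = 0) {t : ℝ} (ht : 0 ≤ t) {a b : ℝ} (ha : 0 ≤ a) (hb : 0 ≤ b) :
    (blockMatrix d (psldCov Γ M ν (p (B t)) (q (B t)) a b)).PosSemidef := by
  refine Matrix.PosSemidef.of_dotProduct_mulVec_nonneg (blockMatrix_psldCov_isHermitian _ _ _ _)
    fun u => ?_
  have h0 := integral_psldDiffusion_propagator hΓ hM hν hpq hβc hβ hB hB0 t u
  rw [dotProduct_psldCov_mulVec, dotProduct_blockMatrix_diag 0 0] at h0
  simp only [zero_mul, add_zero, Finset.sum_const_zero] at h0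
  rw [star_trivial, dotProduct_psldCov_mulVec, ← h0]
  refine add_nonneg (intervalIntegral.integral_nonneg ht fun s _ => ?_) ?_
  · exact Finset.sum_nonneg fun i _ => mul_self_nonneg _
  · simpa using (blockMatrix_diag_posSemidef d ha hb).dotProduct_mulVec_nonneg
      ((blockMatrix d (psldPropagator Γ M ν (p (B t)) (q (B t))))ᵀ *ᵥ u)

end Adjoint

/-! ### Transition law of phase space Langevin diffusion -/

/-- Only the values of the coefficients at nonnegative times enter the equation. -/
theorem IsLinearSDESolution.congr {Ω : Type*} [MeasurableSpace Ω] {P : Measure Ω} {ι : Type*}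
    [Fintype ι] {F G F' G' : ℝ → Matrix ι ι ℝ} {W : ι → ℝ≥0 → Ω → ℝ}
    {Z : ℝ≥0 → Ω → EuclideanSpace ℝ ι} (h : IsLinearSDESolution F G W Z P)
    (hF : ∀ s, 0 ≤ s → F s = F' s) (hG : ∀ s, 0 ≤ s → G s = G' s) :
    IsLinearSDESolution F' G' W Z P where
  wiener := h.wiener
  aemeasurable := h.aemeasurable
  continuous := h.continuous
  indep := h.indep
  equation t := by
    have hsum : wienerSum G' W t = wienerSum G W t := by
      funext n ω
      exact Finset.sum_congr rfl fun k _ => by rw [hG _ (by positivity)]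
    have hint : ∀ ω, ∫ s in (0 : ℝ)..t, WithLp.toLp 2 (F' s *ᵥ (Z s.toNNReal ω).ofLp) =
        ∫ s in (0 : ℝ)..t, WithLp.toLp 2 (F s *ᵥ (Z s.toNNReal ω).ofLp) := fun ω =>
      intervalIntegral.integral_congr fun s hs => by
        rw [Set.uIcc_of_le t.coe_nonneg] at hs
        simp only [hF s hs.1]
    have := h.equation t
    simpa only [IsWienerIntegral, hsum, hint] using this

theorem continuous_blockMatrix {X : Type*} [TopologicalSpace X] (d : ℕ)
    {A : X → Matrix (Fin 2) (Fin 2) ℝ} (hA : Continuous A) :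
    Continuous fun x => blockMatrix d (A x) := by
  refine continuous_matrix fun i j => ?_
  simp only [blockMatrix, Matrix.kroneckerMap_apply]
  exact (hA.matrix_elem i.1 j.1).mul continuous_const

section Law

variable {d : ℕ} {Γ M ν : ℝ} {p q : ℝ → ℝ} {β B : ℝ → ℝ}

/-- Joint characteristic function of the initial value and the value at time `t`. -/
theorem IsPSLD.integral_exp_mul_exp {Ω : Type*} [MeasurableSpace Ω] {P : Measure Ω}
    [IsProbabilityMeasure P] {W : Fin 2 × Fin d → ℝ≥0 → Ω → ℝ} {Z : ℝ≥0 → Ω → PhaseSpace d}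
    (h : IsPSLD d Γ M ν β W Z P) (hΓ : 0 ≤ Γ) (hM : 0 < M) (hν : 0 ≤ ν)
    (hpq : IsPropagatorPair (-(Γ + ν) / 4) ((Γ - ν) ^ 2 / 16 - M⁻¹ / 4) p q)
    (hβc : Continuous β) (hβ : ∀ s, 0 ≤ β s) (hB : ∀ s, HasDerivAt B (β s) s)
    (hB0 : B 0 = 0) (t : ℝ≥0) (w u : PhaseSpace d) :
    ∫ ω, Complex.exp ((inner ℝ (Z 0 ω) w : ℝ) * Complex.I) *
        Complex.exp ((inner ℝ (Z t ω) u : ℝ) * Complex.I) ∂P =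
      charFun (P.map (Z 0)) (w + WithLp.toLp 2
        ((blockMatrix d (psldPropagator Γ M ν (p (B t)) (q (B t))))ᵀ *ᵥ u.ofLp)) *
      Complex.exp (-((u.ofLp ⬝ᵥ (blockMatrix d
        (psldCov Γ M ν (p (B t)) (q (B t)) 0 0) *ᵥ u.ofLp) : ℝ) : ℂ) / 2) := by
  have hF : Continuous (psldDrift d Γ M ν β) := continuous_blockMatrix d (by fun_prop)
  have hG : Continuous (psldDiffusion d Γ M ν β) := continuous_blockMatrix d <|
    continuous_matrix fun i j => by fin_cases i <;> fin_cases j <;> simp <;> fun_prop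
  -- With `v(t) = u`, the initial value enters `⟨Z_0, w⟩ + ⟨Z_t, u⟩` through `w + v(0)`.
  have key := IsLinearSDESolution.integral_exp_mul_exp_adjoint hF hG h
    (hasDerivAt_adjoint_propagator hpq hB (B t) u.ofLp) (w + WithLp.toLp 2
        ((blockMatrix d (psldPropagator Γ M ν (p (B t)) (q (B t))))ᵀ *ᵥ u.ofLp)) t
  rw [integral_psldDiffusion_propagator hΓ hM hν hpq hβc hβ hB hB0] at key
  rw [← key]
  refine integral_congr_ae (ae_of_all _ fun ω => ?_)
  simp only [← Complex.exp_add, ← add_mul, ← Complex.ofReal_add]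
  congr 3
  have hT : (blockMatrix d (psldPropagator Γ M ν 1 0))ᵀ *ᵥ u.ofLp = u.ofLp := by
    simp [psldPropagator_one_zero, blockMatrix]
  rw [sub_self, hpq.p_zero, hpq.q_zero, hT, hB0, sub_zero, inner_add_right]
  simp only [EuclideanSpace.inner_eq_star_dotProduct, star_trivial]
  ring

theorem charFun_affine_gaussian {S : Matrix (Fin 2 × Fin d) (Fin 2 × Fin d) ℝ}
    (hS : S.PosSemidef) (A : Matrix (Fin 2 × Fin d) (Fin 2 × Fin d) ℝ) (z u : PhaseSpace d) :
    charFun (multivariateGaussian (WithLp.toLp 2 (A *ᵥ z.ofLp)) S) u =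
      Complex.exp ((inner ℝ z (WithLp.toLp 2 (Aᵀ *ᵥ u.ofLp)) : ℝ) * Complex.I) *
        Complex.exp (-((u.ofLp ⬝ᵥ (S *ᵥ u.ofLp) : ℝ) : ℂ) / 2) := by
  rw [charFun_multivariateGaussian hS, ← Complex.exp_add]
  have : inner ℝ u (WithLp.toLp 2 (A *ᵥ z.ofLp) : PhaseSpace d) =
      (inner ℝ z (WithLp.toLp 2 (Aᵀ *ᵥ u.ofLp)) : ℝ) := by
    simp only [EuclideanSpace.inner_eq_star_dotProduct, star_trivial]
    rw [dotProduct_comm, Matrix.dotProduct_mulVec, ← Matrix.mulVec_transpose]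
  rw [this]
  congr 1
  ring

theorem map_const_add_multivariateGaussian {ι : Type*} [Fintype ι] [DecidableEq ι]
    (m : EuclideanSpace ℝ ι) (S : Matrix ι ι ℝ) :
    (multivariateGaussian 0 S).map (fun y => m + y) = multivariateGaussian m S := by
  rw [multivariateGaussian, multivariateGaussian, Measure.map_map (by fun_prop) (by fun_prop)]
  simp [Function.comp_def]

/-- The Markov kernel `z ↦ N(A z, S)`. -/
noncomputable def affineGaussianKernel (A S : Matrix (Fin 2 × Fin d) (Fin 2 × Fin d) ℝ) :
    Kernel (PhaseSpace d) (PhaseSpace d) :=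
  (Kernel.id ×ₖ Kernel.const (PhaseSpace d) (multivariateGaussian 0 S)).map
    fun x => Matrix.toEuclideanCLM (𝕜 := ℝ) A x.1 + x.2

theorem affineGaussianKernel_apply (A S : Matrix (Fin 2 × Fin d) (Fin 2 × Fin d) ℝ)
    (z : PhaseSpace d) :
    affineGaussianKernel A S z = multivariateGaussian (WithLp.toLp 2 (A *ᵥ z.ofLp)) S := by
  rw [affineGaussianKernel, Kernel.map_apply _ (by fun_prop), Kernel.prod_apply, Kernel.id_apply,
    Kernel.const_apply, Measure.dirac_prod, Measure.map_map (by fun_prop) (by fun_prop),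
    ← map_const_add_multivariateGaussian (WithLp.toLp 2 (A *ᵥ z.ofLp))]
  rfl

instance (A S : Matrix (Fin 2 × Fin d) (Fin 2 × Fin d) ℝ) :
    IsMarkovKernel (affineGaussianKernel A S) := by
  unfold affineGaussianKernel
  exact Kernel.IsMarkovKernel.map _ (by fun_prop)

/-- If the joint characteristic function of `X` and `Y` is that of `(X, A X + ξ)` with `ξ ∼ N(0, S)`
independent of `X`, then the conditional law of `Y` given `X = z` is `N(A z, S)`: the joint law
determines the conditional one almost everywhere. -/
theorem condDistrib_ae_eq_affineGaussian {Ω : Type*} [MeasurableSpace Ω] {P : Measure Ω}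
    [IsProbabilityMeasure P] {X Y : Ω → PhaseSpace d} (hX : AEMeasurable X P)
    (hY : AEMeasurable Y P) (A : Matrix (Fin 2 × Fin d) (Fin 2 × Fin d) ℝ)
    {S : Matrix (Fin 2 × Fin d) (Fin 2 × Fin d) ℝ} (hS : S.PosSemidef)
    (h : ∀ w u : PhaseSpace d, ∫ ω, Complex.exp ((inner ℝ (X ω) w : ℝ) * Complex.I) *
        Complex.exp ((inner ℝ (Y ω) u : ℝ) * Complex.I) ∂P =
      charFun (P.map X) (w + WithLp.toLp 2 (Aᵀ *ᵥ u.ofLp)) *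
      Complex.exp (-((u.ofLp ⬝ᵥ (S *ᵥ u.ofLp) : ℝ) : ℂ) / 2)) :
    ∀ᵐ z ∂(P.map X), condDistrib Y X P z =
      multivariateGaussian (WithLp.toLp 2 (A *ᵥ z.ofLp)) S := by
  have hPX : IsProbabilityMeasure (P.map X) := Measure.isProbabilityMeasure_map hX
  have hjoint : P.map (fun ω => (X ω, Y ω)) = P.map X ⊗ₘ affineGaussianKernel A S := by
    have hPXY : IsProbabilityMeasure (P.map fun ω => (X ω, Y ω)) :=
      Measure.isProbabilityMeasure_map (hX.prodMk hY)
    refine Measure.ext_of_charFunDual ?_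
    ext L
    obtain ⟨w, u, hL⟩ : ∃ w u : PhaseSpace d, ∀ x y, L (x, y) = inner ℝ x w + inner ℝ y u := by
      refine ⟨(InnerProductSpace.toDual ℝ _).symm (L.comp (ContinuousLinearMap.inl ℝ _ _)),
        (InnerProductSpace.toDual ℝ _).symm (L.comp (ContinuousLinearMap.inr ℝ _ _)),
        fun x y => ?_⟩
      rw [real_inner_comm, real_inner_comm _ y, InnerProductSpace.toDual_symm_apply,
        InnerProductSpace.toDual_symm_apply]
      simp [← map_add]
    have hexp : ∀ x y, Complex.exp ((L (x, y) : ℝ) * Complex.I) =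
        Complex.exp ((inner ℝ x w : ℝ) * Complex.I) *
          Complex.exp ((inner ℝ y u : ℝ) * Complex.I) := fun x y => by
      rw [hL, Complex.ofReal_add, add_mul, Complex.exp_add]
    rw [charFunDual_apply, charFunDual_apply, integral_map (hX.prodMk hY)
      (Measurable.aestronglyMeasurable (by fun_prop)), Measure.integral_compProd]
    · simp only [hexp, h, integral_const_mul, affineGaussianKernel_apply]
      simp only [← charFun_apply, charFun_affine_gaussian hS, ← mul_assoc]
      rw [integral_mul_const]
      congr 1
      rw [charFun_apply]
      refine integral_congr_ae (ae_of_all _ fun x => ?_)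
      simp only [inner_add_right, Complex.ofReal_add, add_mul, Complex.exp_add]
    · refine Integrable.of_bound (C := 1) (Measurable.aestronglyMeasurable (by fun_prop))
        (ae_of_all _ fun x => ?_)
      rw [Complex.norm_exp_ofReal_mul_I]
  filter_upwards [condDistrib_ae_eq_of_measure_eq_compProd X hY hjoint] with z hz
  rw [hz, affineGaussianKernel_apply]

theorem IsPSLD.charFun_map {Ω : Type*} [MeasurableSpace Ω] {P : Measure Ω}
    [IsProbabilityMeasure P] {W : Fin 2 × Fin d → ℝ≥0 → Ω → ℝ} {Z : ℝ≥0 → Ω → PhaseSpace d}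
    (h : IsPSLD d Γ M ν β W Z P) (hΓ : 0 ≤ Γ) (hM : 0 < M) (hν : 0 ≤ ν)
    (hpq : IsPropagatorPair (-(Γ + ν) / 4) ((Γ - ν) ^ 2 / 16 - M⁻¹ / 4) p q)
    (hβc : Continuous β) (hβ : ∀ s, 0 ≤ β s) (hB : ∀ s, HasDerivAt B (β s) s)
    (hB0 : B 0 = 0) (t : ℝ≥0) (u : PhaseSpace d) :
    charFun (P.map (Z t)) u = charFun (P.map (Z 0)) (WithLp.toLp 2
        ((blockMatrix d (psldPropagator Γ M ν (p (B t)) (q (B t))))ᵀ *ᵥ u.ofLp)) *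
      Complex.exp (-((u.ofLp ⬝ᵥ (blockMatrix d
        (psldCov Γ M ν (p (B t)) (q (B t)) 0 0) *ᵥ u.ofLp) : ℝ) : ℂ) / 2) := by
  have := h.integral_exp_mul_exp hΓ hM hν hpq hβc hβ hB hB0 t 0 u
  rw [zero_add] at this
  rw [← this, charFun_apply, integral_map (h.aemeasurable t)
    (Measurable.aestronglyMeasurable (by fun_prop))]
  simp

/-- A Gaussian initial value with covariance `diag(a, b) ⊗ I_d` stays Gaussian. -/
theorem IsPSLD.map_eq_multivariateGaussian {Ω : Type*} [MeasurableSpace Ω] {P : Measure Ω}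
    [IsProbabilityMeasure P] {W : Fin 2 × Fin d → ℝ≥0 → Ω → ℝ} {Z : ℝ≥0 → Ω → PhaseSpace d}
    (h : IsPSLD d Γ M ν β W Z P) (hΓ : 0 ≤ Γ) (hM : 0 < M) (hν : 0 ≤ ν)
    (hpq : IsPropagatorPair (-(Γ + ν) / 4) ((Γ - ν) ^ 2 / 16 - M⁻¹ / 4) p q)
    (hβc : Continuous β) (hβ : ∀ s, 0 ≤ β s) (hB : ∀ s, HasDerivAt B (β s) s)
    (hB0 : B 0 = 0) {a b : ℝ} (ha : 0 ≤ a) (hb : 0 ≤ b) {z : PhaseSpace d}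
    (h0 : P.map (Z 0) = multivariateGaussian z (blockMatrix d !![a, 0; 0, b])) (t : ℝ≥0) :
    P.map (Z t) = multivariateGaussian
      (WithLp.toLp 2 (blockMatrix d (psldPropagator Γ M ν (p (B t)) (q (B t))) *ᵥ z.ofLp))
      (blockMatrix d (psldCov Γ M ν (p (B t)) (q (B t)) a b)) := by
  have hprob := Measure.isProbabilityMeasure_map (h.aemeasurable t)
  refine Measure.ext_of_charFun ?_
  ext u
  rw [h.charFun_map hΓ hM hν hpq hβc hβ hB hB0, h0, charFun_affine_gaussian
    (blockMatrix_psldCov_posSemidef hΓ hM hν hpq hβc hβ hB hB0 t.coe_nonneg ha hb),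
    charFun_multivariateGaussian (blockMatrix_diag_posSemidef d ha hb), ← Complex.exp_add,
    ← Complex.exp_add, dotProduct_psldCov_mulVec, dotProduct_psldCov_mulVec _ _ a b,
    dotProduct_blockMatrix_diag 0 0, real_inner_comm]
  congr 1
  simp only [zero_mul, add_zero, Finset.sum_const_zero]
  push_cast
  ring

end Law

/-! ### Convergence to the prior -/

/-- Lévy's continuity theorem, along a continuous time parameter. -/
theorem convergesWeakly_of_tendsto_charFun {d : ℕ} {ρ : ℝ≥0 → Measure (PhaseSpace d)}
    {π : Measure (PhaseSpace d)} (hρ : ∀ t, IsProbabilityMeasure (ρ t))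
    [hπ : IsProbabilityMeasure π]
    (h : ∀ u, Tendsto (fun t => charFun (ρ t) u) atTop (𝓝 (charFun π u))) :
    ConvergesWeakly ρ π := by
  intro f
  refine tendsto_of_seq_tendsto fun τ hτ => ?_
  let ρ' : ℕ → ProbabilityMeasure (PhaseSpace d) := fun n => ⟨ρ (τ n), hρ _⟩
  let π' : ProbabilityMeasure (PhaseSpace d) := ⟨π, hπ⟩
  have hlim : Tendsto ρ' atTop (𝓝 π') :=
    ProbabilityMeasure.tendsto_of_tendsto_charFun fun u => (h u).comp hτ
  exact ProbabilityMeasure.tendsto_iff_forall_integral_tendsto.mp hlim f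

theorem psldPrior_eq (d : ℕ) {M : ℝ} (hM : 0 ≤ M) :
    psldPrior d M = multivariateGaussian 0 (blockMatrix d !![1, 0; 0, M]) := by
  have hcont : Continuous fun p : EuclideanSpace ℝ (Fin d) × EuclideanSpace ℝ (Fin d) =>
      phasePoint p.1 p.2 := by
    refine (PiLp.continuous_toLp 2 _).comp (continuous_pi ?_)
    rintro ⟨i, k⟩
    fin_cases i <;> simp <;> fun_prop
  have hone : (1 : Matrix (Fin d) (Fin d) ℝ).PosSemidef := Matrix.PosSemidef.one
  have hprob : IsProbabilityMeasure (psldPrior d M) :=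
    Measure.isProbabilityMeasure_map hcont.measurable.aemeasurable
  refine Measure.ext_of_charFun ?_
  ext u
  rw [charFun_multivariateGaussian (blockMatrix_diag_posSemidef d zero_le_one hM),
    dotProduct_blockMatrix_diag, psldPrior, charFun_apply,
    integral_map hcont.measurable.aemeasurable (Measurable.aestronglyMeasurable (by fun_prop))]
  have hinner : ∀ x m : EuclideanSpace ℝ (Fin d), inner ℝ (phasePoint x m) u =
      (inner ℝ x (WithLp.toLp 2 fun k => u (0, k)) : ℝ) +
        inner ℝ m (WithLp.toLp 2 fun k => u (1, k)) := fun x m => by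
    simp [PiLp.inner_apply, phasePoint, Fintype.sum_prod_type]
  simp only [hinner, Complex.ofReal_add, add_mul, Complex.exp_add]
  rw [integral_prod_mul (fun x : EuclideanSpace ℝ (Fin d) =>
    Complex.exp ((inner ℝ x (WithLp.toLp 2 fun k => u (0, k)) : ℝ) * Complex.I))
    (fun m : EuclideanSpace ℝ (Fin d) =>
    Complex.exp ((inner ℝ m (WithLp.toLp 2 fun k => u (1, k)) : ℝ) * Complex.I)),
    ← charFun_apply, ← charFun_apply, charFun_multivariateGaussian hone,
    charFun_multivariateGaussian (hone.smul hM), ← Complex.exp_add]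
  congr 1
  simp only [inner_zero_right, Complex.ofReal_zero, zero_mul, zero_sub, Matrix.one_mulVec,
    Matrix.smul_mulVec, dotProduct_smul, smul_eq_mul, Finset.sum_add_distrib, ← Finset.mul_sum]
  simp only [dotProduct, ← sq]
  push_cast
  ring

theorem continuous_psldPropagator (Γ M ν : ℝ) :
    Continuous fun x : ℝ × ℝ => psldPropagator Γ M ν x.1 x.2 :=
  continuous_matrix fun i j => by
    fin_cases i <;> fin_cases j <;> simp [psldPropagator] <;> fun_prop

theorem continuous_psldCov (Γ M ν a b : ℝ) :
    Continuous fun x : ℝ × ℝ => psldCov Γ M ν x.1 x.2 a b := by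
  unfold psldCov
  have h := continuous_psldPropagator Γ M ν
  exact continuous_const.add ((h.matrix_mul continuous_const).matrix_mul h.matrix_transpose)

theorem psldPropagator_zero_zero (Γ M ν : ℝ) : psldPropagator Γ M ν 0 0 = 0 := by
  ext i j
  fin_cases i <;> fin_cases j <;> simp [psldPropagator]

theorem psldCov_zero_zero (Γ M ν a b : ℝ) : psldCov Γ M ν 0 0 a b = !![1, 0; 0, M] := by
  simp [psldCov, psldPropagator_zero_zero]

theorem tendsto_blockMatrix_psldCov (d : ℕ) (Γ M ν a b : ℝ) {α : Type*} {l : Filter α}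
    {x y : α → ℝ} (hx : Tendsto x l (𝓝 0)) (hy : Tendsto y l (𝓝 0)) :
    Tendsto (fun t => blockMatrix d (psldCov Γ M ν (x t) (y t) a b)) l
      (𝓝 (blockMatrix d !![1, 0; 0, M])) := by
  have hc := continuous_blockMatrix d (continuous_psldCov Γ M ν a b)
  have h := (hc.tendsto ((0 : ℝ), (0 : ℝ))).comp (hx.prodMk_nhds hy)
  simp only [psldCov_zero_zero, Function.comp_def] at h
  exact h

theorem tendsto_blockMatrix_psldPropagator (d : ℕ) (Γ M ν : ℝ) {α : Type*} {l : Filter α}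
    {x y : α → ℝ} (hx : Tendsto x l (𝓝 0)) (hy : Tendsto y l (𝓝 0)) :
    Tendsto (fun t => blockMatrix d (psldPropagator Γ M ν (x t) (y t))) l (𝓝 0) := by
  have hc := continuous_blockMatrix d (continuous_psldPropagator Γ M ν)
  have h := (hc.tendsto ((0 : ℝ), (0 : ℝ))).comp (hx.prodMk_nhds hy)
  have h0 : blockMatrix d 0 = 0 := Matrix.zero_kronecker _
  simp only [psldPropagator_zero_zero, h0, Function.comp_def] at h
  exact h

/-- If matrices tend to zero, so do their products with a fixed vector. -/
theorem tendsto_toLp_mulVec_zero {d : ℕ} {α : Type*} {l : Filter α}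
    {A : α → Matrix (Fin 2 × Fin d) (Fin 2 × Fin d) ℝ} (hA : Tendsto A l (𝓝 0))
    (z : PhaseSpace d) :
    Tendsto (fun t => (WithLp.toLp 2 (A t *ᵥ z.ofLp) : PhaseSpace d)) l (𝓝 0) := by
  have hcont : Continuous fun X : Matrix (Fin 2 × Fin d) (Fin 2 × Fin d) ℝ =>
      (WithLp.toLp 2 (X *ᵥ z.ofLp) : PhaseSpace d) :=
    (PiLp.continuous_toLp 2 _).comp (continuous_id.matrix_mulVec continuous_const)
  have h := hcont.tendsto 0
  rw [Matrix.zero_mulVec, WithLp.toLp_zero] at h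
  exact h.comp hA

theorem tendsto_toLp_transpose_mulVec_zero {d : ℕ} {α : Type*} {l : Filter α}
    {A : α → Matrix (Fin 2 × Fin d) (Fin 2 × Fin d) ℝ} (hA : Tendsto A l (𝓝 0))
    (z : PhaseSpace d) :
    Tendsto (fun t => (WithLp.toLp 2 ((A t)ᵀ *ᵥ z.ofLp) : PhaseSpace d)) l (𝓝 0) := by
  refine tendsto_toLp_mulVec_zero ?_ z
  have hcont : Continuous fun X : Matrix (Fin 2 × Fin d) (Fin 2 × Fin d) ℝ => Xᵀ :=
    continuous_id.matrix_transpose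
  have h := hcont.tendsto 0
  rw [Matrix.transpose_zero] at h
  exact h.comp hA

theorem tendsto_exp_neg_quadraticForm {d : ℕ} {M : ℝ} (hM : 0 ≤ M) {α : Type*} {l : Filter α}
    {S : α → Matrix (Fin 2 × Fin d) (Fin 2 × Fin d) ℝ}
    (hS : Tendsto S l (𝓝 (blockMatrix d !![1, 0; 0, M]))) (u : PhaseSpace d) :
    Tendsto (fun t => Complex.exp (-((u.ofLp ⬝ᵥ (S t *ᵥ u.ofLp) : ℝ) : ℂ) / 2)) l
      (𝓝 (charFun (psldPrior d M) u)) := by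
  have hcont : Continuous fun X : Matrix (Fin 2 × Fin d) (Fin 2 × Fin d) ℝ =>
      Complex.exp (-((u.ofLp ⬝ᵥ (X *ᵥ u.ofLp) : ℝ) : ℂ) / 2) := by
    have : Continuous fun X : Matrix (Fin 2 × Fin d) (Fin 2 × Fin d) ℝ =>
        u.ofLp ⬝ᵥ (X *ᵥ u.ofLp) :=
      continuous_const.dotProduct (continuous_id.matrix_mulVec continuous_const)
    fun_prop
  rw [psldPrior_eq d hM,
    charFun_multivariateGaussian (blockMatrix_diag_posSemidef d zero_le_one hM), inner_zero_right,
    Complex.ofReal_zero, zero_mul, zero_sub, ← neg_div]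
  exact (hcont.tendsto _).comp hS

theorem mainTheorem1 (d : ℕ) (Γ M ν : ℝ) (hΓ : 0 ≤ Γ) (hν : 0 ≤ ν) (hΓν : 0 < Γ + ν)
    (hM : 0 < M) (β : ℝ → ℝ) (hβ_cont : ContinuousOn β (Set.Ici 0))
    (hβ_nonneg : ∀ t, 0 ≤ t → 0 ≤ β t)
    (hβ_int : Tendsto (fun t : ℝ => ∫ s in (0 : ℝ)..t, β s) atTop atTop) :
    ∃ (μ : ℝ≥0 → PhaseSpace d → PhaseSpace d)
      (S : ℝ → ℝ → ℝ≥0 → Matrix (Fin 2 × Fin d) (Fin 2 × Fin d) ℝ),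
      (∀ a b : ℝ, 0 ≤ a → 0 ≤ b → ∀ t, (S a b t).PosSemidef) ∧
      -- the perturbation kernel `p(z_t | z_0)` is `N(μ_t(z_0), Σ_t)`
      (∀ (Ω : Type u) [MeasurableSpace Ω] (P : Measure Ω) [IsProbabilityMeasure P]
        (W : Fin 2 × Fin d → ℝ≥0 → Ω → ℝ) (Z : ℝ≥0 → Ω → PhaseSpace d),
        IsPSLD d Γ M ν β W Z P → ∀ t, ∀ᵐ z₀ ∂(P.map (Z 0)),
          condDistrib (Z t) (Z 0) P z₀ = multivariateGaussian (μ t z₀) (S 0 0 t)) ∧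
      -- the law at time `t` for a Gaussian initial value with covariance `diag(a, b) ⊗ I_d`
      (∀ (Ω : Type u) [MeasurableSpace Ω] (P : Measure Ω) [IsProbabilityMeasure P]
        (W : Fin 2 × Fin d → ℝ≥0 → Ω → ℝ) (Z : ℝ≥0 → Ω → PhaseSpace d),
        IsPSLD d Γ M ν β W Z P → ∀ (a b : ℝ) (z₀ : PhaseSpace d), 0 ≤ a → 0 ≤ b →
          P.map (Z 0) = multivariateGaussian z₀ (blockMatrix d !![a, 0; 0, b]) →
          ∀ t, P.map (Z t) = multivariateGaussian (μ t z₀) (S a b t)) ∧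
      -- mean and covariance converge
      (∀ z₀, Tendsto (fun t => μ t z₀) atTop (𝓝 0)) ∧
      (∀ a b : ℝ, 0 ≤ a → 0 ≤ b →
        Tendsto (S a b) atTop (𝓝 (blockMatrix d !![1, 0; 0, M]))) ∧
      -- the kernels converge to the prior
      (∀ (a b : ℝ) (z₀ : PhaseSpace d), 0 ≤ a → 0 ≤ b →
        ConvergesWeakly (fun t => multivariateGaussian (μ t z₀) (S a b t)) (psldPrior d M)) ∧
      -- the process converges to the prior, whatever the law of its initial value
      (∀ (Ω : Type u) [MeasurableSpace Ω] (P : Measure Ω) [IsProbabilityMeasure P]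
        (W : Fin 2 × Fin d → ℝ≥0 → Ω → ℝ) (Z : ℝ≥0 → Ω → PhaseSpace d),
        IsPSLD d Γ M ν β W Z P → ConvergesWeakly (fun t => P.map (Z t)) (psldPrior d M)) ∧
      -- the explicit formulas for critical damping
      ((Γ - ν) ^ 2 = 4 * M⁻¹ → ∀ t : ℝ≥0,
        (∀ x₀ m₀ : EuclideanSpace ℝ (Fin d), μ t (phasePoint x₀ m₀) =
          criticalMean Γ ν (∫ s in (0 : ℝ)..t, β s) x₀ m₀) ∧
        ∀ a b : ℝ, 0 ≤ a → 0 ≤ b →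
          S a b t = blockMatrix d (criticalCov Γ M ν (∫ s in (0 : ℝ)..t, β s) a b)) := by
  -- Only the values of `β` on `[0, ∞)` matter; extend it to a continuous function on the line.
  let β' : ℝ → ℝ := fun s => β (max s 0)
  have hβ'c : Continuous β' :=
    hβ_cont.comp_continuous (by fun_prop) fun s => le_max_right s 0
  have hβ' : ∀ s, 0 ≤ β' s := fun s => hβ_nonneg _ (le_max_right s 0)
  have hβ'eq : ∀ s, 0 ≤ s → β s = β' s := fun s hs => by simp only [β', max_eq_left hs]
  let B : ℝ → ℝ := fun t => ∫ s in (0 : ℝ)..t, β' s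
  have hB : ∀ s, HasDerivAt B (β' s) s := fun s =>
    (hβ'c.integral_hasStrictDerivAt 0 s).hasDerivAt
  have hB0 : B 0 = 0 := intervalIntegral.integral_same
  have hBeq : ∀ t : ℝ, 0 ≤ t → ∫ s in (0 : ℝ)..t, β s = B t := fun t ht =>
    intervalIntegral.integral_congr fun s hs => hβ'eq s (Set.uIcc_of_le ht ▸ hs).1
  have hBlim : Tendsto (fun t : ℝ≥0 => B t) atTop atTop :=
    (hβ_int.comp (NNReal.tendsto_coe_atTop.mpr tendsto_id)).congr fun t => hBeq t t.coe_nonneg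
  obtain ⟨p, q, hpq⟩ := exists_isPropagatorPair (-(Γ + ν) / 4) ((Γ - ν) ^ 2 / 16 - M⁻¹ / 4)
  have hc : -(Γ + ν) / 4 < 0 := by linarith
  -- `c² - δ` is the determinant `(Γ ν + M⁻¹) / 4` of the drift matrix in the time scale `B`.
  have hδ : (Γ - ν) ^ 2 / 16 - M⁻¹ / 4 < (-(Γ + ν) / 4) ^ 2 := by
    have := inv_pos.mpr hM
    nlinarith [mul_nonneg hΓ hν]
  have hp0 : Tendsto (fun t : ℝ≥0 => p (B t)) atTop (𝓝 0) := (hpq.tendsto_p hc hδ).comp hBlim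
  have hq0 : Tendsto (fun t : ℝ≥0 => q (B t)) atTop (𝓝 0) := (hpq.tendsto_q hc hδ).comp hBlim
  have hsol : ∀ {Ω : Type u} [MeasurableSpace Ω] {P : Measure Ω}
      {W : Fin 2 × Fin d → ℝ≥0 → Ω → ℝ} {Z : ℝ≥0 → Ω → PhaseSpace d},
      IsPSLD d Γ M ν β W Z P → IsPSLD d Γ M ν β' W Z P := fun h =>
    IsLinearSDESolution.congr h (fun s hs => by simp only [psldDrift, hβ'eq s hs])
      fun s hs => by simp only [psldDiffusion, hβ'eq s hs]
  let S : ℝ → ℝ → ℝ≥0 → Matrix (Fin 2 × Fin d) (Fin 2 × Fin d) ℝ := fun a b t =>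
    blockMatrix d (psldCov Γ M ν (p (B t)) (q (B t)) a b)
  let A : ℝ≥0 → Matrix (Fin 2 × Fin d) (Fin 2 × Fin d) ℝ := fun t =>
    blockMatrix d (psldPropagator Γ M ν (p (B t)) (q (B t)))
  have hS : ∀ a b : ℝ, 0 ≤ a → 0 ≤ b → ∀ t, (S a b t).PosSemidef := fun a b ha hb t =>
    blockMatrix_psldCov_posSemidef hΓ hM hν hpq hβ'c hβ' hB hB0 t.coe_nonneg ha hb
  have hSlim : ∀ a b : ℝ, Tendsto (S a b) atTop (𝓝 (blockMatrix d !![1, 0; 0, M])) :=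
    fun a b => tendsto_blockMatrix_psldCov d Γ M ν a b hp0 hq0
  have hAlim : Tendsto A atTop (𝓝 0) := tendsto_blockMatrix_psldPropagator d Γ M ν hp0 hq0
  have hprior : IsProbabilityMeasure (psldPrior d M) := by
    rw [psldPrior_eq d hM.le]
    infer_instance
  refine ⟨fun t z => WithLp.toLp 2 (A t *ᵥ z.ofLp), S, hS, ?_, ?_,
    fun z => tendsto_toLp_mulVec_zero hAlim z, fun a b _ _ => hSlim a b, ?_, ?_, ?_⟩
  · intro Ω _ P _ W Z h t
    exact condDistrib_ae_eq_affineGaussian (h.aemeasurable 0) (h.aemeasurable t) (A t)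
      (hS 0 0 le_rfl le_rfl t)
      ((hsol h).integral_exp_mul_exp hΓ hM hν hpq hβ'c hβ' hB hB0 t)
  · intro Ω _ P _ W Z h a b z ha hb h0 t
    exact (hsol h).map_eq_multivariateGaussian hΓ hM hν hpq hβ'c hβ' hB hB0 ha hb h0 t
  · intro a b z ha hb
    refine convergesWeakly_of_tendsto_charFun (fun t => inferInstance) fun u => ?_
    have hmean : Tendsto (fun t => Complex.exp
        ((inner ℝ z (WithLp.toLp 2 ((A t)ᵀ *ᵥ u.ofLp)) : ℝ) * Complex.I)) atTop (𝓝 1) := by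
      have hcont : Continuous fun x : PhaseSpace d =>
          Complex.exp ((inner ℝ z x : ℝ) * Complex.I) := by fun_prop
      have h0 := hcont.tendsto 0
      rw [inner_zero_right, Complex.ofReal_zero, zero_mul, Complex.exp_zero] at h0
      exact h0.comp (tendsto_toLp_transpose_mulVec_zero hAlim u)
    have := hmean.mul (tendsto_exp_neg_quadraticForm hM.le (hSlim a b) u)
    rw [one_mul] at this
    exact this.congr fun t => (charFun_affine_gaussian (hS a b ha hb t) (A t) z u).symm
  · -- The initial value contributes its characteristic function at a point tending to `0`.
    intro Ω _ P _ W Z h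
    have hprob := fun t => Measure.isProbabilityMeasure_map (h.aemeasurable t)
    refine convergesWeakly_of_tendsto_charFun hprob fun u => ?_
    have hinit : Tendsto (fun t => charFun (P.map (Z 0))
        (WithLp.toLp 2 ((A t)ᵀ *ᵥ u.ofLp))) atTop (𝓝 1) := by
      have hcont : Continuous (charFun (P.map (Z 0))) := continuous_charFun
      have hprob0 : ((P.map (Z 0)).real Set.univ : ℂ) = 1 := by
        have := hprob 0
        rw [probReal_univ, Complex.ofReal_one]
      have h0 := hcont.tendsto 0
      rw [charFun_zero, hprob0] at h0
      exact h0.comp (tendsto_toLp_transpose_mulVec_zero hAlim u)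
    have := hinit.mul (tendsto_exp_neg_quadraticForm hM.le (hSlim 0 0) u)
    rw [one_mul] at this
    exact this.congr fun t =>
      ((hsol h).charFun_map hΓ hM hν hpq hβ'c hβ' hB hB0 t u).symm
  · intro hcrit t
    obtain ⟨hp, hq⟩ := hpq.eq_of_critical (by linarith) (B t)
    rw [hBeq t t.coe_nonneg]
    refine ⟨fun x₀ m₀ => ?_, fun a b _ _ => ?_⟩
    · simp only [A, hp, hq]
      exact criticalMean_eq hcrit (B t) x₀ m₀
    · simp only [S, hp, hq, psldCov_critical hM hcrit]
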